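/- Work in the hyperboloid model of $\mathbb H^3$ with Lorentzian form $\langle\cdot,\cdot\rangle$ of signature $(3,1)$. Let $T$ be a doubly truncated tetrahedron: $\mathrm v_1,\mathrm v_2$ are ultra-ideal (unit spacelike vectors), $\mathrm v_3,\mathrm v_4\in\mathbb H^3$ are proper, and $T$ is truncated by the polar planes of $\mathrm v_1,\mathrm v_2$, keeping the half-spaces $\langle x,\mathrm v_i\rangle\le 0$ ($i=1,2$). We assume that $\mathrm v_3,\mathrm v_4$ are strictly inside both half-spaces, and that each point where one of the edges $e_{13},e_{14},e_{23},e_{24}$ meets the polar plane of its ultra-ideal end is strictly inside the other half-space. Let $a_{kl}$ be the dihedral angle and $\ell_{kl}$ the length of the (truncated) edge $e_{kl}$ joining $\mathrm v_k$ and $\mathrm v_l$. $T$ is mildly truncated if the two polar planes are ultraparallel, and prism truncated if they intersect in $\mathbb H^3$. In the latter case they meet along a new edge of $T$, of length $\ell$ and with dihedral angle $\mu$, which joins the faces opposite to $\mathrm v_3$ and $\mathrm v_4$ and replaces $e_{12}$; we write $\theta_1,\theta_2,\theta_3,\theta_5,\theta_6$ for the dihedral angles and $\ell_1,\ell_2,\ell_3,\ell_5,\ell_6$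 for the lengths of $e_{34},e_{13},e_{23},e_{24},e_{14}$. Put $\varepsilon=(\varepsilon_1,\varepsilon_2,\varepsilon_3,\varepsilon_4)=(-1,-1,1,1)$. For complex $a=(a_{12},a_{13},a_{14},a_{23},a_{24},a_{34})$ and $L=(\ell_{12},\ell_{13},\ell_{14},\ell_{23},\ell_{24},\ell_{34})$ (symmetric in the two indices) let $$\sigma_{kl}=\tfrac12e^{\ell_{kl}}-\tfrac12\varepsilon_k\varepsilon_le^{-\ell_{kl}},\qquad \sigma'_{kl}=\tfrac12e^{\ell_{kl}}+\tfrac12\varepsilon_k\varepsilon_le^{-\ell_{kl}},$$ $$\omega_{kl}=\frac{-\sigma'_{ik}\sigma'_{jl}+\varepsilon_l\sigma'_{il}\sigma'_{jl}\sigma'_{kl}-\sigma'_{il}\sigma'_{jk}+\varepsilon_k\sigma'_{ik}\sigma'_{jk}\sigma'_{kl}}{\sigma_{kl}^2}\qquad(\{i,j,k,l\}=\{1,2,3,4\}),$$ let $G(a)$ be the symmetric $4\times4$ matrix with diagonal entries $1$ and with $(i,j)$ entry $-\cos a_{kl}$ for $\{i,j,k,l\}=\{1,2,3,4\}$, let $G_{ii}$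 be $G$ without its $i$-th row and column, and let $$\eta=\Big(\frac{\prod_{i=1}^4\varepsilon_i\det G_{ii}}{(-\det G)^3}\Big)^{1/2}$$ (principal branch). Let $\mathscr D=\mathrm{diag}(\sigma_{12},\sigma_{13},\sigma_{14},\sigma_{23},\sigma_{24},\sigma_{34})$, and let $\mathscr S$ be the symmetric $6\times 6$ matrix with rows and columns indexed by the edges $12,13,14,23,24,34$, whose entry is $\omega_{kl}$ at $(kl,kl)$, is $1$ for two opposite edges, and is $\varepsilon_k\sigma'_{kj}$ for two edges $kl,ki$ with exactly the vertex $k$ in common, where $\{i,j,k,l\}=\{1,2,3,4\}$. Put $\mathscr J(a,L)=-\eta\,\mathscr D\mathscr S\mathscr D$, the dual Jacobian formula. **Theorem.** The vectors $(\ell,\theta_1,\theta_2,\theta_3,\theta_5,\theta_6)$ of prism truncated tetrahedra form an open set in $\mathbb R^6$. There are a function $F:\mathbb R^6\to\mathbb R^6$ and a function $\Lambda:\mathbb C^6\to\mathbb C^6$ such that: 1. $F(\ell,\theta_1,\theta_2,\theta_3,\theta_5,\theta_6)=(\mu,\ell_1,\ell_2,\ell_3,\ell_5,\ell_6)$ for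 every prism truncated tetrahedron. 2. For every mildly doubly truncated tetrahedron, with $a=(a_{12},\dots,a_{34})$ and $L=(\ell_{12},\dots,\ell_{34})$: $\Lambda$ is analytic at $a$, $\Lambda(a)=L$, and the complex Jacobian matrix of $\Lambda$ at $a$ is $\mathscr J(a,L)$. 3. For every doubly truncated tetrahedron in the limiting case where the two polar planes are tangent at infinity, $\Lambda$ is analytic at $(0,a_{13},\dots,a_{34})$, with value $(0,\ell_{13},\dots,\ell_{34})$. 4. For every prism truncated tetrahedron, with $a$ and $L$ completed by $a_{12}:=\sqrt{-1}\,\ell$ and $\ell_{12}:=\sqrt{-1}\,\mu$: $\Lambda$ is analytic at $a$, $\Lambda(a)=L$, and the complex Jacobian matrix of $\Lambda$ at $a$ is $\mathscr J(a,L)$. Moreover $F$ is differentiable at $(\ell,\theta_1,\theta_2,\theta_3,\theta_5,\theta_6)$, and its Jacobian matrix there, the dual Jacobian of $T$, is obtained from $\mathscr J(a,L)$ by this substitution: $$\mathrm{Jac}^\star(T)=\frac{\partial(\mu,\ell_1,\ell_2,\ell_3,\ell_5,\ell_6)}{\partial(\ell,\theta_1,\theta_2,\theta_3,\theta_5,\theta_6)}=R^{-1}\,\frac{\partial(\ell_{12},\ell_{34},\ell_{13},\ell_{23},\ell_{24},\ell_{14})}{\partial(a_{12},a_{34},a_{13},a_{23},a_{24},a_{14})}\,R,\qquad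 R=\mathrm{diag}(\sqrt{-1},1,1,1,1,1),$$ where the matrix between $R^{-1}$ and $R$ is $\mathscr J(a,L)$ with its rows and columns put in the order $12,34,13,23,24,14$. -/

import Mathlib

noncomputable section

namespace DualJacobian

/-- The Lorentzian inner product of signature `(3,1)` on `ℝ⁴`. -/
def mink (x y : Fin 4 → ℝ) : ℝ :=
  -(x 0 * y 0) + x 1 * y 1 + x 2 * y 2 + x 3 * y 3

/-- Hyperbolic distance in the hyperboloid model
`ℍ³ = {x | mink x x = -1, 0 < x 0}`: `cosh d(x,y) = -mink x y`. -/
def hdist (x y : Fin 4 → ℝ) : ℝ := Real.arcosh (-mink x y)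

/-- Central projection of a future timelike vector to the hyperboloid. -/
def normalise (x : Fin 4 → ℝ) : Fin 4 → ℝ := (Real.sqrt (-mink x x))⁻¹ • x

/-- A doubly truncated hyperbolic tetrahedron. The vertices `v 0`, `v 1` are ultra-ideal
(unit spacelike vectors, with polar planes `{x ∈ ℍ³ | mink x (v i) = 0}`), the vertices
`v 2`, `v 3` are proper points of `ℍ³`. The truncation keeps the half-spaces
`mink x (v i) ≤ 0`, `i = 0, 1`, so `v 0` and `v 1` are the outer unit normals of the two
truncating faces. -/
structure DoublyTruncated where
  /-- the vertices -/
  v : Fin 4 → Fin 4 → ℝ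
  /-- `n i` is the outer unit normal of the face opposite to `v i` -/
  n : Fin 4 → Fin 4 → ℝ
  ultra : ∀ i, i < 2 → mink (v i) (v i) = 1
  proper : ∀ j, 2 ≤ j → mink (v j) (v j) = -1 ∧ 0 < v j 0
  normal_unit : ∀ i, mink (n i) (n i) = 1
  normal_orth : ∀ i j, i ≠ j → mink (n i) (v j) = 0
  normal_outer : ∀ i, mink (n i) (v i) < 0
  /-- the proper vertices are not cut off -/
  kept : ∀ i j, i < 2 → 2 ≤ j → mink (v i) (v j) < 0
  /-- the point where the edge from the proper vertex `v j` meets the polar plane of `v i`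
  is not cut off by the other polar plane (this holds by itself if these planes are disjoint) -/
  cut : ∀ i k j, i < 2 → k < 2 → i ≠ k → 2 ≤ j →
    mink (v j - mink (v i) (v j) • v i) (v k) < 0

namespace DoublyTruncated

variable (T : DoublyTruncated)

/-- Mild truncation: the two truncating planes are ultraparallel. -/
def IsMild : Prop := mink (T.v 0) (T.v 1) < -1

/-- The limiting case: the two truncating planes are tangent at infinity. -/
def IsTangent : Prop := mink (T.v 0) (T.v 1) = -1

/-- Prism truncation: the two truncating planes intersect in `ℍ³`. -/
def IsPrism : Prop := |mink (T.v 0) (T.v 1)| < 1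

/-- The interior dihedral angle between the faces opposite to `v i` and to `v j`, that is,
along the edge that joins the other two vertices. -/
def dihedral (i j : Fin 4) : ℝ := Real.arccos (-mink (T.n i) (T.n j))

/-- The endpoint next to `v i` of the (truncated) edge from `v i` to `v j`: the vertex `v i`
if it is proper, the point of the edge on the polar plane of `v i` if `v i` is ultra-ideal. -/
def edgeEnd (i j : Fin 4) : Fin 4 → ℝ :=
  if i < 2 then normalise (T.v j - mink (T.v i) (T.v j) • T.v i) else T.v i

/-- The length of the (truncated) edge from `v i` to `v j`. -/
def edgeLength (i j : Fin 4) : ℝ := hdist (T.edgeEnd i j) (T.edgeEnd j i)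

/-- For prism truncation and `j = 2, 3`: the point common to both truncating planes and the
face through `v 0`, `v 1`, `v j`, obtained by projecting `v j` orthogonally to the line in
which the truncating planes meet. -/
def ridgeEnd (j : Fin 4) : Fin 4 → ℝ :=
  let c := mink (T.v 0) (T.v 1)
  let s := mink (T.v 0) (T.v j)
  let t := mink (T.v 1) (T.v j)
  normalise (T.v j - ((s - c * t) / (1 - c ^ 2)) • T.v 0 - ((t - c * s) / (1 - c ^ 2)) • T.v 1)

/-- The length `ℓ` of the edge in which the truncating planes of a prism truncated
tetrahedron meet. -/
def ridgeLength : ℝ := hdist (T.ridgeEnd 2) (T.ridgeEnd 3)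

/-- The dihedral angle `μ` along that edge, between the faces with outer normals `v 0`, `v 1`. -/
def ridgeAngle : ℝ := Real.arccos (-mink (T.v 0) (T.v 1))

/-- `(ℓ, θ₁, θ₂, θ₃, θ₅, θ₆)`, where `θ₁, θ₂, θ₃, θ₅, θ₆` are the dihedral angles along the
edges `34, 13, 23, 24, 14` (vertices numbered from `1`). -/
def prismParams : Fin 6 → ℝ :=
  ![T.ridgeLength, T.dihedral 0 1, T.dihedral 1 3, T.dihedral 0 3, T.dihedral 0 2,
    T.dihedral 1 2]

/-- `(μ, ℓ₁, ℓ₂, ℓ₃, ℓ₅, ℓ₆)`, where `ℓ₁, ℓ₂, ℓ₃, ℓ₅, ℓ₆` are the lengths of the edges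
`34, 13, 23, 24, 14`. -/
def prismDuals : Fin 6 → ℝ :=
  ![T.ridgeAngle, T.edgeLength 2 3, T.edgeLength 0 2, T.edgeLength 1 2, T.edgeLength 1 3,
    T.edgeLength 0 3]

/-- `(a₁₂, a₁₃, a₁₄, a₂₃, a₂₄, a₃₄)` with the value `z` in the place of `a₁₂`. -/
def angles (z : ℂ) : Fin 6 → ℂ :=
  ![z, (T.dihedral 1 3 : ℂ), (T.dihedral 1 2 : ℂ), (T.dihedral 0 3 : ℂ), (T.dihedral 0 2 : ℂ),
    (T.dihedral 0 1 : ℂ)]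

/-- `(ℓ₁₂, ℓ₁₃, ℓ₁₄, ℓ₂₃, ℓ₂₄, ℓ₃₄)` with the value `z` in the place of `ℓ₁₂`. -/
def lengths (z : ℂ) : Fin 6 → ℂ :=
  ![z, (T.edgeLength 0 2 : ℂ), (T.edgeLength 0 3 : ℂ), (T.edgeLength 1 2 : ℂ),
    (T.edgeLength 1 3 : ℂ), (T.edgeLength 2 3 : ℂ)]

end DoublyTruncated

/-- The Gram matrix as a function of `a = (a₁₂, a₁₃, a₁₄, a₂₃, a₂₄, a₃₄)`. -/
def gram (a : Fin 6 → ℂ) : Matrix (Fin 4) (Fin 4) ℂ :=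
  !![1, -Complex.cos (a 5), -Complex.cos (a 4), -Complex.cos (a 3);
     -Complex.cos (a 5), 1, -Complex.cos (a 2), -Complex.cos (a 1);
     -Complex.cos (a 4), -Complex.cos (a 2), 1, -Complex.cos (a 0);
     -Complex.cos (a 3), -Complex.cos (a 1), -Complex.cos (a 0), 1]

/-- `η`, with the principal square root (the radicand is positive on tetrahedra). -/
def eta (ε : Fin 4 → ℂ) (a : Fin 6 → ℂ) : ℂ :=
  ((∏ i, ε i * ((gram a).submatrix i.succAbove i.succAbove).det) / (-(gram a).det) ^ 3)
    ^ (1 / 2 : ℂ)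

/-- The number of the edge `kl` in the list `12, 13, 14, 23, 24, 34` (vertices numbered from
`0` here; the diagonal is irrelevant). -/
def edgeIdx : Fin 4 → Fin 4 → Fin 6 :=
  ![![0, 0, 1, 2], ![0, 0, 3, 4], ![1, 3, 0, 5], ![2, 4, 5, 0]]

/-- `σ_{kl}` as a function of `L = (ℓ₁₂, ℓ₁₃, ℓ₁₄, ℓ₂₃, ℓ₂₄, ℓ₃₄)`. -/
def sig (ε : Fin 4 → ℂ) (L : Fin 6 → ℂ) (k l : Fin 4) : ℂ :=
  Complex.exp (L (edgeIdx k l)) / 2 - ε k * ε l * Complex.exp (-L (edgeIdx k l)) / 2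

/-- `σ'_{kl}`, the derivative of `σ_{kl}` with respect to `ℓ_{kl}`. -/
def sig' (ε : Fin 4 → ℂ) (L : Fin 6 → ℂ) (k l : Fin 4) : ℂ :=
  Complex.exp (L (edgeIdx k l)) / 2 + ε k * ε l * Complex.exp (-L (edgeIdx k l)) / 2

/-- `ω_{kl}`, for `{i, j, k, l} = {0, 1, 2, 3}`. -/
def omega (ε : Fin 4 → ℂ) (L : Fin 6 → ℂ) (i j k l : Fin 4) : ℂ :=
  (-(sig' ε L i k * sig' ε L j l) + ε l * sig' ε L i l * sig' ε L j l * sig' ε L k l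
    - sig' ε L i l * sig' ε L j k + ε k * sig' ε L i k * sig' ε L j k * sig' ε L k l)
    / sig ε L k l ^ 2

/-- The diagonal matrix `𝒟`. -/
def matD (ε : Fin 4 → ℂ) (L : Fin 6 → ℂ) : Matrix (Fin 6) (Fin 6) ℂ :=
  Matrix.diagonal ![sig ε L 0 1, sig ε L 0 2, sig ε L 0 3, sig ε L 1 2, sig ε L 1 3, sig ε L 2 3]

/-- The symmetric matrix `𝒮`, rows and columns ordered as `12, 13, 14, 23, 24, 34`. -/
def matS (ε : Fin 4 → ℂ) (L : Fin 6 → ℂ) : Matrix (Fin 6) (Fin 6) ℂ :=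
  let s := sig' ε L
  let w := omega ε L
  !![w 2 3 0 1, ε 0 * s 0 3, ε 0 * s 0 2, ε 1 * s 1 3, ε 1 * s 1 2, 1;
     ε 0 * s 0 3, w 1 3 0 2, ε 0 * s 0 1, ε 2 * s 2 3, 1, ε 2 * s 1 2;
     ε 0 * s 0 2, ε 0 * s 0 1, w 1 2 0 3, 1, ε 3 * s 2 3, ε 3 * s 1 3;
     ε 1 * s 1 3, ε 2 * s 2 3, 1, w 0 3 1 2, ε 1 * s 0 1, ε 2 * s 0 2;
     ε 1 * s 1 2, 1, ε 3 * s 2 3, ε 1 * s 0 1, w 0 2 1 3, ε 3 * s 0 3;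
     1, ε 2 * s 1 2, ε 3 * s 1 3, ε 2 * s 0 2, ε 3 * s 0 3, w 0 1 2 3]

/-- The dual Jacobian formula `-η 𝒟 𝒮 𝒟` as an analytic expression in complex angles `a` and
complex lengths `L`. -/
def jacFormula (ε : Fin 4 → ℂ) (a L : Fin 6 → ℂ) : Matrix (Fin 6) (Fin 6) ℂ :=
  -(eta ε a) • (matD ε L * matS ε L * matD ε L)

/-- `ε = (-1, -1, 1, 1)`: two ultra-ideal and two proper vertices. -/
def epsDT : Fin 4 → ℂ := ![-1, -1, 1, 1]

/-- The places of the edges `12, 34, 13, 23, 24, 14` in the list `12, 13, 14, 23, 24, 34`. -/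
def reorder : Fin 6 → Fin 6 := ![0, 5, 1, 3, 4, 2]

/-- The factors in the substitution `a₁₂ = i ℓ`, `ℓ₁₂ = i μ` (and `1` for the other edges),
in the order `12, 34, 13, 23, 24, 14`. -/
def rot : Fin 6 → ℂ := ![Complex.I, 1, 1, 1, 1, 1]

/-- The continuous linear map with matrix `M`. -/
def matCLM {𝕜 : Type*} [NontriviallyNormedField 𝕜] [CompleteSpace 𝕜]
    (M : Matrix (Fin 6) (Fin 6) 𝕜) : (Fin 6 → 𝕜) →L[𝕜] (Fin 6 → 𝕜) :=
  LinearMap.toContinuousLinearMap (Matrix.toLin' M)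

end DualJacobian

end

/-! ### Edge lengths as analytic functions of complex dihedral angles. -/

noncomputable section

namespace DualJacobian

open Complex Matrix

/-! One analytic function, `lengthFun`, serves all three kinds of truncation. Let `G` be the Gram
matrix of the face normals. Up to scaling, the vertices form the basis dual to the normals, so the
cofactors of `G`, normalised by the square roots of the principal ones, are the numbers `x_kl = -⟨v
k, v l⟩`. The length satisfies `e^ℓ = x + σ` with `σ² = x² - ε_k ε_l`. Taking this root directly
would branch where the truncating planes become tangent. Jacobi's identity for complementary minors
removes the branching: `σ = sin a · √(-det G) / √(ε_k c_kk ε_l c_ll)`, with `c_kk` the principal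
cofactors, and on tetrahedra these radicands are positive. Along the edge 12, `e^ℓ` is then a
positive number for mild truncation, 1 for tangent planes, and `e^(iμ)` with `0 < μ < π` for prism
truncation. The logarithm is analytic at each of these.

For the Jacobian, differentiating `adj G · G = det G · 1` gives the derivative of the cofactors. The
normalised cofactors are homogeneous of degree zero, so the derivative of `det G` drops out. Since
`dx = σ dℓ`, what remains is `-η 𝒟 𝒮 𝒟` (`Regular.normCof_fderiv`, `matS_entry`,
`Regular.lengthFun_hasFDerivAt`).

In the prism case the ridge is the common perpendicular of the faces opposite to the proper
vertices, so `cosh ℓ = -⟨n 2, n 3⟩` (`ridgeLength_eq`), which is `cos (iℓ) = -G 2 3`. The parameters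
form an open set because the Gram map is a submersion at independent normals (`map_nhds_gramMap`)
and the conditions on the vertices are open. On this open set the rotated lengths are real, so the
rotated complex Jacobian is real and is the dual Jacobian. -/

/-- The vertex `k` of the edge `kl` with the given number, `k < l`. -/
def fstV : Fin 6 → Fin 4 := ![0, 0, 0, 1, 1, 2]

/-- The vertex `l` of the edge `kl` with the given number, `k < l`. -/
def sndV : Fin 6 → Fin 4 := ![1, 2, 3, 2, 3, 3]

/-- The vertex `i` of the opposite edge `ij`, `i < j`. -/
def fstO : Fin 6 → Fin 4 := ![2, 1, 1, 0, 0, 0]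

/-- The vertex `j` of the opposite edge `ij`, `i < j`. -/
def sndO : Fin 6 → Fin 4 := ![3, 3, 2, 3, 2, 1]

/-- The cofactors of the Gram matrix. -/
def cof (a : Fin 6 → ℂ) : Matrix (Fin 4) (Fin 4) ℂ := (gram a).adjugate

/-- The square root of `ε k` times the `k`-th principal cofactor. -/
def rootCof (ε : Fin 4 → ℂ) (a : Fin 6 → ℂ) (k : Fin 4) : ℂ := (ε k * cof a k k) ^ (1 / 2 : ℂ)

/-- The square root of `-det G`. -/
def rootDet (a : Fin 6 → ℂ) : ℂ := (-(gram a).det) ^ (1 / 2 : ℂ)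

/-- The normalised cofactors; on tetrahedra these are the numbers `-⟨v k, v l⟩`. -/
def normCof (ε : Fin 4 → ℂ) (a : Fin 6 → ℂ) (k l : Fin 4) : ℂ :=
  cof a k l / (rootCof ε a k * rootCof ε a l)

/-- The function which on tetrahedra is `σ_{kl}`. -/
def sigFun (ε : Fin 4 → ℂ) (a : Fin 6 → ℂ) (e : Fin 6) : ℂ :=
  Complex.sin (a e) * (rootDet a / (rootCof ε a (fstV e) * rootCof ε a (sndV e)))

/-- The exponential of the edge length as a function of the dihedral angles. -/
def expLength (ε : Fin 4 → ℂ) (a : Fin 6 → ℂ) (e : Fin 6) : ℂ :=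
  normCof ε a (fstV e) (sndV e) + sigFun ε a e

/-- The edge lengths as functions of the dihedral angles. -/
def lengthFun (ε : Fin 4 → ℂ) (a : Fin 6 → ℂ) : Fin 6 → ℂ := fun e => Complex.log (expLength ε a e)

theorem gram_transpose (a : Fin 6 → ℂ) : (gram a)ᵀ = gram a := by
  ext i j; fin_cases i <;> fin_cases j <;> simp [gram]

theorem cof_comm (a : Fin 6 → ℂ) (k l : Fin 4) : cof a k l = cof a l k := by
  have h := congrFun (congrFun (adjugate_transpose (gram a)) k) l
  rw [gram_transpose] at h
  simpa [cof] using h.symm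

theorem normCof_comm (ε : Fin 4 → ℂ) (a : Fin 6 → ℂ) (k l : Fin 4) :
    normCof ε a k l = normCof ε a l k := by
  rw [normCof, normCof, cof_comm, mul_comm (rootCof ε a k)]

/-- Jacobi's identity for the complementary minors of the Gram matrix. -/
theorem cof_sq_sub (a : Fin 6 → ℂ) (e : Fin 6) :
    cof a (fstV e) (sndV e) ^ 2 - cof a (fstV e) (fstV e) * cof a (sndV e) (sndV e) =
      -(gram a).det * Complex.sin (a e) ^ 2 := by
  rw [Complex.sin_sq]
  simp only [cof, adjugate_fin_succ_eq_det_submatrix, gram, det_succ_row_zero (n := 3),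
    Fin.sum_univ_four, det_fin_three]
  fin_cases e <;> simp [fstV, sndV, Fin.succAbove, Fin.lt_def] <;> ring

theorem det_analyticAt {n : Type*} [Fintype n] [DecidableEq n] {M : (Fin 6 → ℂ) → Matrix n n ℂ}
    {a : Fin 6 → ℂ} (h : ∀ i j, AnalyticAt ℂ (fun b => M b i j) a) :
    AnalyticAt ℂ (fun b => (M b).det) a := by
  simp only [det_apply']
  exact Finset.analyticAt_fun_sum _ fun σ _ =>
    analyticAt_const.mul (Finset.analyticAt_fun_prod _ fun i _ => h _ _)

theorem cos_coord_analyticAt (a : Fin 6 → ℂ) (e : Fin 6) :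
    AnalyticAt ℂ (fun b : Fin 6 → ℂ => Complex.cos (b e)) a :=
  Complex.analyticAt_cos.fun_comp (ContinuousLinearMap.analyticAt
    (ContinuousLinearMap.proj (R := ℂ) (φ := fun _ : Fin 6 => ℂ) e) a)

theorem sin_coord_analyticAt (a : Fin 6 → ℂ) (e : Fin 6) :
    AnalyticAt ℂ (fun b : Fin 6 → ℂ => Complex.sin (b e)) a :=
  Complex.analyticAt_sin.fun_comp (ContinuousLinearMap.analyticAt
    (ContinuousLinearMap.proj (R := ℂ) (φ := fun _ : Fin 6 => ℂ) e) a)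

theorem gram_analyticAt (a : Fin 6 → ℂ) (i j : Fin 4) :
    AnalyticAt ℂ (fun b => gram b i j) a := by
  fin_cases i <;> fin_cases j <;>
    first
    | exact analyticAt_const
    | exact (cos_coord_analyticAt a _).neg

theorem gram_det_analyticAt (a : Fin 6 → ℂ) : AnalyticAt ℂ (fun b => (gram b).det) a :=
  det_analyticAt (gram_analyticAt a)

theorem cof_analyticAt (a : Fin 6 → ℂ) (k l : Fin 4) : AnalyticAt ℂ (fun b => cof b k l) a := by
  simp only [cof, adjugate_fin_succ_eq_det_submatrix]
  exact analyticAt_const.mul (det_analyticAt fun i j => gram_analyticAt a _ _)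

/-- The region in which the square roots in `lengthFun` stay away from the branch cut. -/
structure Regular (ε : Fin 4 → ℂ) (a : Fin 6 → ℂ) : Prop where
  cof_mem : ∀ k, ε k * cof a k k ∈ slitPlane
  det_mem : -(gram a).det ∈ slitPlane
  exp_mem : ∀ e, expLength ε a e ∈ slitPlane

section

variable {ε : Fin 4 → ℂ} {a : Fin 6 → ℂ}

theorem rootCof_sq (ε : Fin 4 → ℂ) (a : Fin 6 → ℂ) (k : Fin 4) :
    rootCof ε a k ^ 2 = ε k * cof a k k := by
  rw [rootCof, ← cpow_nat_mul]; norm_num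

theorem rootDet_sq (a : Fin 6 → ℂ) : rootDet a ^ 2 = -(gram a).det := by
  rw [rootDet, ← cpow_nat_mul]; norm_num

theorem Regular.rootCof_ne_zero (h : Regular ε a) (k : Fin 4) : rootCof ε a k ≠ 0 := by
  intro h0
  have := rootCof_sq ε a k
  rw [h0] at this
  exact slitPlane_ne_zero (h.cof_mem k) (by simpa using this.symm)

theorem Regular.rootDet_ne_zero (h : Regular ε a) : rootDet a ≠ 0 := by
  intro h0
  have := rootDet_sq a
  rw [h0] at this
  exact slitPlane_ne_zero h.det_mem (by simpa using this.symm)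

theorem Regular.rootCof_analyticAt (h : Regular ε a) (k : Fin 4) :
    AnalyticAt ℂ (fun b => rootCof ε b k) a :=
  (analyticAt_const.mul (cof_analyticAt a k k)).cpow analyticAt_const (h.cof_mem k)

theorem Regular.normCof_analyticAt (h : Regular ε a) (k l : Fin 4) :
    AnalyticAt ℂ (fun b => normCof ε b k l) a :=
  (cof_analyticAt a k l).fun_div ((h.rootCof_analyticAt k).mul (h.rootCof_analyticAt l))
    (mul_ne_zero (h.rootCof_ne_zero k) (h.rootCof_ne_zero l))

theorem Regular.sigFun_analyticAt (h : Regular ε a) (e : Fin 6) :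
    AnalyticAt ℂ (fun b => sigFun ε b e) a :=
  (sin_coord_analyticAt a e).mul
    (((gram_det_analyticAt a).neg.cpow analyticAt_const h.det_mem).fun_div
      ((h.rootCof_analyticAt _).mul (h.rootCof_analyticAt _))
      (mul_ne_zero (h.rootCof_ne_zero _) (h.rootCof_ne_zero _)))

theorem Regular.expLength_analyticAt (h : Regular ε a) (e : Fin 6) :
    AnalyticAt ℂ (fun b => expLength ε b e) a :=
  (h.normCof_analyticAt _ _).add (h.sigFun_analyticAt e)

theorem Regular.lengthFun_analyticAt (h : Regular ε a) : AnalyticAt ℂ (lengthFun ε) a :=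
  AnalyticAt.pi fun e => (h.expLength_analyticAt e).clog (h.exp_mem e)

theorem Regular.eventually (h : Regular ε a) : ∀ᶠ b in nhds a, Regular ε b := by
  have h1 : ∀ᶠ b in nhds a, ∀ k, ε k * cof b k k ∈ slitPlane :=
    Filter.eventually_all.2 fun k =>
      (continuousAt_const.mul (cof_analyticAt a k k).continuousAt).eventually_mem
        (isOpen_slitPlane.mem_nhds (h.cof_mem k))
  have h2 : ∀ᶠ b in nhds a, -(gram b).det ∈ slitPlane :=
    (gram_det_analyticAt a).neg.continuousAt.eventually_mem (isOpen_slitPlane.mem_nhds h.det_mem)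
  have h3 : ∀ᶠ b in nhds a, ∀ e, expLength ε b e ∈ slitPlane :=
    Filter.eventually_all.2 fun e =>
      (h.expLength_analyticAt e).continuousAt.eventually_mem
        (isOpen_slitPlane.mem_nhds (h.exp_mem e))
  filter_upwards [h1, h2, h3] with b c1 c2 c3 using ⟨c1, c2, c3⟩

theorem Regular.normCof_self (h : Regular ε a) (hε : ∀ k, ε k ^ 2 = 1) (k : Fin 4) :
    normCof ε a k k = ε k := by
  have h0 := h.rootCof_ne_zero k
  rw [normCof, div_eq_iff (mul_ne_zero h0 h0)]
  linear_combination (-ε k) * rootCof_sq ε a k - cof a k k * hε k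

/-- Jacobi's identity after normalisation. It makes `x + σ` and `x - σ` multiply to `ε_k ε_l`, so
that `x` and `σ` are recovered from the logarithm of `x + σ` as `σ'` and `σ` of the formula. -/
theorem Regular.normCof_sq_sub (h : Regular ε a) (hε : ∀ k, ε k ^ 2 = 1) (e : Fin 6) :
    normCof ε a (fstV e) (sndV e) ^ 2 - ε (fstV e) * ε (sndV e) = sigFun ε a e ^ 2 := by
  have h1 := h.rootCof_ne_zero (fstV e)
  have h2 := h.rootCof_ne_zero (sndV e)
  have e1 := rootCof_sq ε a (fstV e)
  have e2 := rootCof_sq ε a (sndV e)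
  have e3 := rootDet_sq a
  have e4 := cof_sq_sub a e
  have n1 := hε (fstV e)
  have n2 := hε (sndV e)
  rw [normCof, sigFun]
  field_simp
  rw [e1, e2, e3]
  linear_combination e4 - cof a (fstV e) (fstV e) * cof a (sndV e) (sndV e) *
    (ε (sndV e) ^ 2 * n1 + n2)

theorem Regular.exp_neg_lengthFun (h : Regular ε a) (hε : ∀ k, ε k ^ 2 = 1) (e : Fin 6) :
    ε (fstV e) * ε (sndV e) * Complex.exp (-lengthFun ε a e) =
      normCof ε a (fstV e) (sndV e) - sigFun ε a e := by
  rw [Complex.exp_neg, lengthFun, Complex.exp_log (slitPlane_ne_zero (h.exp_mem e)),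
    ← div_eq_mul_inv, div_eq_iff (slitPlane_ne_zero (h.exp_mem e)), expLength]
  linear_combination -h.normCof_sq_sub hε e

theorem Regular.exp_lengthFun (h : Regular ε a) (e : Fin 6) :
    Complex.exp (lengthFun ε a e) = normCof ε a (fstV e) (sndV e) + sigFun ε a e := by
  rw [lengthFun, Complex.exp_log (slitPlane_ne_zero (h.exp_mem e)), expLength]

theorem edgeIdx_fstV_sndV (e : Fin 6) : edgeIdx (fstV e) (sndV e) = e := by
  fin_cases e <;> rfl

theorem Regular.sig_lengthFun (h : Regular ε a) (hε : ∀ k, ε k ^ 2 = 1) (e : Fin 6) :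
    sig ε (lengthFun ε a) (fstV e) (sndV e) = sigFun ε a e := by
  rw [sig, edgeIdx_fstV_sndV]
  linear_combination (h.exp_lengthFun e - h.exp_neg_lengthFun hε e) / 2

theorem Regular.sig'_lengthFun (h : Regular ε a) (hε : ∀ k, ε k ^ 2 = 1) (e : Fin 6) :
    sig' ε (lengthFun ε a) (fstV e) (sndV e) = normCof ε a (fstV e) (sndV e) := by
  rw [sig', edgeIdx_fstV_sndV]
  linear_combination (h.exp_lengthFun e + h.exp_neg_lengthFun hε e) / 2

end

/-! ### Derivatives of the Gram matrix and of its adjugate. -/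

/-- The derivative of the Gram matrix in the direction `v`. -/
def gramDeriv (a v : Fin 6 → ℂ) : Matrix (Fin 4) (Fin 4) ℂ :=
  let s : Fin 6 → ℂ := fun e => Complex.sin (a e) * v e
  !![0, s 5, s 4, s 3; s 5, 0, s 2, s 1; s 4, s 2, 0, s 0; s 3, s 1, s 0, 0]

theorem gram_hasLineDerivAt (a v : Fin 6 → ℂ) (i j : Fin 4) :
    HasDerivAt (fun t : ℂ => gram (a + t • v) i j) (gramDeriv a v i j) 0 := by
  have key (e : Fin 6) : HasDerivAt (fun t : ℂ => -Complex.cos ((a + t • v) e))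
      (Complex.sin (a e) * v e) 0 := by
    have h1 : HasDerivAt (fun t : ℂ => (a + t • v) e) (v e) 0 := by
      simpa using ((hasDerivAt_id (0 : ℂ)).mul_const (v e)).const_add (a e)
    simpa using h1.ccos.fun_neg
  fin_cases i <;> fin_cases j <;>
    first
    | exact key _
    | exact hasDerivAt_const _ _

/-- The angle `a f` occurs in `G` only at the two symmetric places indexed by the edge opposite to
`f`. -/
theorem cof_gramDeriv_cof (a : Fin 6 → ℂ) (f : Fin 6) (k l : Fin 4) :
    (cof a * gramDeriv a (Pi.single f 1) * cof a) k l = Complex.sin (a f) *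
      (cof a k (fstO f) * cof a (sndO f) l + cof a k (sndO f) * cof a (fstO f) l) := by
  simp only [mul_apply, Fin.sum_univ_four]
  fin_cases f <;> simp [gramDeriv, fstO, sndO] <;> ring

/-- The derivative of the adjugate of an invertible matrix. -/
theorem adjugate_deriv {n : Type*} [Fintype n] [DecidableEq n] {G : ℂ → Matrix n n ℂ}
    {G' C' : Matrix n n ℂ} {δ t₀ : ℂ} (hG : ∀ i j, HasDerivAt (fun t => G t i j) (G' i j) t₀)
    (hC : ∀ i j, HasDerivAt (fun t => (G t).adjugate i j) (C' i j) t₀)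
    (hδ : HasDerivAt (fun t => (G t).det) δ t₀) :
    (G t₀).det • C' = δ • (G t₀).adjugate - (G t₀).adjugate * G' * (G t₀).adjugate := by
  -- This is the derivative of `adj G · G = det G · 1`; multiplying it by `adj G` on the right
  -- isolates `C'`.
  have h : C' * G t₀ + (G t₀).adjugate * G' = δ • (1 : Matrix n n ℂ) := by
    ext i j
    have h1 : HasDerivAt (fun t => ∑ m, (G t).adjugate i m * G t m j)
        (∑ m, (C' i m * G t₀ m j + (G t₀).adjugate i m * G' m j)) t₀ :=
      HasDerivAt.fun_sum fun m _ => (hC i m).mul (hG m j)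
    have h2 : (fun t => ∑ m, (G t).adjugate i m * G t m j) =
        fun t => (G t).det * (1 : Matrix n n ℂ) i j := by
      funext t
      simpa [mul_apply] using congrFun (congrFun (adjugate_mul (G t)) i) j
    rw [h2] at h1
    have := h1.unique (hδ.mul_const _)
    simpa [mul_apply, Finset.sum_add_distrib] using this
  have h3 := congrArg (· * (G t₀).adjugate) h
  simp only [add_mul, mul_assoc, mul_adjugate, smul_mul, one_mul] at h3
  rw [mul_assoc, ← h3]
  simp

end DualJacobian
end

/-! ### The Jacobian of the length function and the matrix `𝒮`. -/

noncomputable section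

namespace DualJacobian

open Complex Matrix

section

variable {ε : Fin 4 → ℂ} {a : Fin 6 → ℂ}

/-- The derivative of the adjugate has a part proportional to the adjugate and a part `adj G · G' ·
adj G`. The first rescales all cofactors alike and leaves the normalised ones fixed. The second
gives the first two terms of the bracket; the other two come from the normalising roots. -/
theorem Regular.normCof_fderiv (h : Regular ε a) (hε : ∀ k, ε k ^ 2 = 1) (k l : Fin 4)
    (f : Fin 6) :
    fderiv ℂ (fun b => normCof ε b k l) a (Pi.single f 1) =
      Complex.sin (a f) * (rootCof ε a (fstO f) * rootCof ε a (sndO f) / rootDet a ^ 2) *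
        (normCof ε a k (fstO f) * normCof ε a l (sndO f) +
          normCof ε a k (sndO f) * normCof ε a l (fstO f) -
          ε k * normCof ε a k l * normCof ε a k (fstO f) * normCof ε a k (sndO f) -
          ε l * normCof ε a k l * normCof ε a l (fstO f) * normCof ε a l (sndO f)) := by
  set v : Fin 6 → ℂ := Pi.single f 1 with hv
  set i := fstO f with hi
  set j := sndO f with hj
  set C' : Matrix (Fin 4) (Fin 4) ℂ := of fun m n => fderiv ℂ (fun b => cof b m n) a v with hC'
  set r' : Fin 4 → ℂ := fun m => fderiv ℂ (fun b => rootCof ε b m) a v with hr'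
  have hC (m n : Fin 4) : HasDerivAt (fun t : ℂ => cof (a + t • v) m n) (C' m n) 0 :=
    (cof_analyticAt a m n).differentiableAt.hasFDerivAt.hasLineDerivAt v
  have hr (m : Fin 4) : HasDerivAt (fun t : ℂ => rootCof ε (a + t • v) m) (r' m) 0 :=
    (h.rootCof_analyticAt m).differentiableAt.hasFDerivAt.hasLineDerivAt v
  have hd : HasDerivAt (fun t : ℂ => (gram (a + t • v)).det)
      (fderiv ℂ (fun b => (gram b).det) a v) 0 :=
    (gram_det_analyticAt a).differentiableAt.hasFDerivAt.hasLineDerivAt v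
  set δ := fderiv ℂ (fun b => (gram b).det) a v
  have hX : HasDerivAt (fun t : ℂ => normCof ε (a + t • v) k l)
      (fderiv ℂ (fun b => normCof ε b k l) a v) 0 :=
    (h.normCof_analyticAt k l).differentiableAt.hasFDerivAt.hasLineDerivAt v
  set X' := fderiv ℂ (fun b => normCof ε b k l) a v
  have h0 : a + (0 : ℂ) • v = a := by simp
  have hadj := adjugate_deriv (gram_hasLineDerivAt a v) hC hd
  rw [h0] at hadj
  have hadj' (m n : Fin 4) : (gram a).det * C' m n = δ * cof a m n -
      Complex.sin (a f) * (cof a m i * cof a j n + cof a m j * cof a i n) := by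
    rw [hi, hj, ← cof_gramDeriv_cof]
    exact congrFun (congrFun hadj m) n
  have hroot (m : Fin 4) : 2 * rootCof ε a m * r' m = ε m * C' m m := by
    have h1 := (hr m).fun_pow 2
    have h2 := (hC m m).const_mul (ε m)
    simp only [rootCof_sq, h0] at h1
    have := h1.unique h2
    simpa using this
  have rne := h.rootCof_ne_zero
  have hcof (m n : Fin 4) : cof a m n = normCof ε a m n * rootCof ε a m * rootCof ε a n := by
    have := rne m
    have := rne n
    rw [normCof]; field_simp
  have hX' : X' * (rootCof ε a k * rootCof ε a l) =
      C' k l - normCof ε a k l * (r' k * rootCof ε a l + rootCof ε a k * r' l) := by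
    have h1 := (hC k l).fun_div ((hr k).fun_mul (hr l)) (by simpa using ⟨rne k, rne l⟩)
    have h2 := hX.unique h1
    have := rne k
    have := rne l
    rw [h2, h0, normCof]
    field_simp
  have dne := h.rootDet_ne_zero
  have hdet : (gram a).det = -rootDet a ^ 2 := by rw [rootDet_sq]; ring
  -- The logarithmic derivative of each root contains the same multiple of `δ`; two of them cancel
  -- the `δ` in `C' k l`.
  have hr2 (m : Fin 4) : r' m * rootDet a ^ 2 = rootCof ε a m * (-δ / 2 +
      Complex.sin (a f) * ε m * normCof ε a m i * normCof ε a m j *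
        (rootCof ε a i * rootCof ε a j)) := by
    have h1 := hadj' m m
    have h2 := hroot m
    have h3 := rne m
    rw [hcof m m, hcof m i, hcof j m, hcof m j, hcof i m, h.normCof_self hε,
      normCof_comm ε a j m, normCof_comm ε a i m, hdet] at h1
    refine mul_left_cancel₀ (mul_ne_zero two_ne_zero h3) ?_
    linear_combination rootDet a ^ 2 * h2 - ε m * h1 - δ * rootCof ε a m ^ 2 * hε m
  have h1 := hadj' k l
  rw [hcof k l, hcof k i, hcof j l, hcof k j, hcof i l,
    normCof_comm ε a j l, normCof_comm ε a i l, hdet] at h1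
  refine mul_left_cancel₀ (mul_ne_zero (mul_ne_zero (rne k) (rne l)) (pow_ne_zero 2 dne)) ?_
  field_simp
  linear_combination rootDet a ^ 2 * hX' - h1 -
    normCof ε a k l * (rootCof ε a l * hr2 k + rootCof ε a k * hr2 l)

/-- Near a regular point `x = (e^ℓ + ε_k ε_l e^(-ℓ)) / 2`, hence `dx = σ dℓ`. This spares
differentiating `σ` as a function of the angles. -/
theorem Regular.lengthFun_fderiv_mul (h : Regular ε a) (hε : ∀ k, ε k ^ 2 = 1) (e : Fin 6)
    (v : Fin 6 → ℂ) :
    fderiv ℂ (lengthFun ε) a v e * sigFun ε a e =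
      fderiv ℂ (fun b => normCof ε b (fstV e) (sndV e)) a v := by
  have hd := hasFDerivAt_pi'.1 h.lengthFun_analyticAt.differentiableAt.hasFDerivAt e
  have h1 := hd.cexp
  have h2 := (hd.fun_neg.cexp).const_mul (ε (fstV e) * ε (sndV e))
  have h3 := (h1.fun_add h2).const_mul (1 / 2)
  have h4 : (fun b => normCof ε b (fstV e) (sndV e)) =ᶠ[nhds a] fun b => 1 / 2 *
      (Complex.exp (lengthFun ε b e) +
        ε (fstV e) * ε (sndV e) * Complex.exp (-lengthFun ε b e)) := by
    filter_upwards [h.eventually] with b hb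
    rw [hb.exp_neg_lengthFun hε, hb.exp_lengthFun]; ring
  rw [(h3.congr_of_eventuallyEq h4).fderiv]
  have e1 := h.exp_lengthFun e
  have e2 := h.exp_neg_lengthFun hε e
  simp
  linear_combination -(fderiv ℂ (lengthFun ε) a v e) * (e1 - e2) / 2

theorem sig'_eq_of_edges {L : Fin 6 → ℂ} {x : Fin 4 → Fin 4 → ℂ} (hx : ∀ k l, x k l = x l k)
    (h : ∀ e, sig' ε L (fstV e) (sndV e) = x (fstV e) (sndV e)) (k l : Fin 4) (hkl : k ≠ l) :
    sig' ε L k l = x k l := by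
  have hc (k l : Fin 4) : sig' ε L k l = sig' ε L l k := by
    rw [sig', sig', show edgeIdx k l = edgeIdx l k by fin_cases k <;> fin_cases l <;> rfl]
    ring
  fin_cases k <;> fin_cases l <;>
    first
    | exact absurd rfl hkl
    | exact h 0
    | exact h 1
    | exact h 2
    | exact h 3
    | exact h 4
    | exact h 5
    | exact (hc _ _).trans ((h 0).trans (hx _ _))
    | exact (hc _ _).trans ((h 1).trans (hx _ _))
    | exact (hc _ _).trans ((h 2).trans (hx _ _))
    | exact (hc _ _).trans ((h 3).trans (hx _ _))
    | exact (hc _ _).trans ((h 4).trans (hx _ _))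
    | exact (hc _ _).trans ((h 5).trans (hx _ _))

/-- The entries of `𝒮` in terms of the normalised cofactors. -/
theorem matS_entry {L : Fin 6 → ℂ} {x : Fin 4 → Fin 4 → ℂ} (hx : ∀ k l, x k l = x l k)
    (hd : ∀ k, x k k = ε k) (hε : ∀ k, ε k ^ 2 = 1)
    (h : ∀ e, sig' ε L (fstV e) (sndV e) = x (fstV e) (sndV e))
    (hs : ∀ e, x (fstV e) (sndV e) ^ 2 - ε (fstV e) * ε (sndV e) =
      sig ε L (fstV e) (sndV e) ^ 2)
    (hne : ∀ e, sig ε L (fstV e) (sndV e) ≠ 0) (e f : Fin 6) :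
    x (fstV e) (fstO f) * x (sndV e) (sndO f) + x (fstV e) (sndO f) * x (sndV e) (fstO f) -
        ε (fstV e) * x (fstV e) (sndV e) * x (fstV e) (fstO f) * x (fstV e) (sndO f) -
        ε (sndV e) * x (fstV e) (sndV e) * x (sndV e) (fstO f) * x (sndV e) (sndO f) =
      -sig ε L (fstV e) (sndV e) ^ 2 * matS ε L e f := by
  have h' := sig'_eq_of_edges hx h
  have hw (i j k l : Fin 4) (hn : sig ε L k l ≠ 0) (hik : i ≠ k) (hil : i ≠ l) (hjk : j ≠ k)
      (hjl : j ≠ l) (hkl : k ≠ l) : -sig ε L k l ^ 2 * omega ε L i j k l =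
      x k i * x l j + x k j * x l i - ε k * x k l * x k i * x k j
        - ε l * x k l * x l i * x l j := by
    rw [omega, h' _ _ hik, h' _ _ hil, h' _ _ hjk, h' _ _ hjl, h' _ _ hkl, hx i k, hx i l,
      hx j k, hx j l]
    field_simp
    ring
  have k0 := hε 0
  have k1 := hε 1
  have k2 := hε 2
  have k3 := hε 3
  have s0 := hs e
  have w0 := hw 2 3 0 1 (hne 0) (by decide) (by decide) (by decide) (by decide) (by decide)
  have w1 := hw 1 3 0 2 (hne 1) (by decide) (by decide) (by decide) (by decide) (by decide)
  have w2 := hw 1 2 0 3 (hne 2) (by decide) (by decide) (by decide) (by decide) (by decide)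
  have w3 := hw 0 3 1 2 (hne 3) (by decide) (by decide) (by decide) (by decide) (by decide)
  have w4 := hw 0 2 1 3 (hne 4) (by decide) (by decide) (by decide) (by decide) (by decide)
  have w5 := hw 0 1 2 3 (hne 5) (by decide) (by decide) (by decide) (by decide) (by decide)
  clear hw hs hne h
  -- For `e ≠ f` the edge opposite to `f` meets `e`, so some factor is `x k k = ε k` and `x_kl² -
  -- ε_k ε_l` splits off. For `e = f` the expression is the numerator of `ω` up to sign.
  have hrest : e ≠ f → x (fstV e) (fstO f) * x (sndV e) (sndO f)
      + x (fstV e) (sndO f) * x (sndV e) (fstO f) -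
        ε (fstV e) * x (fstV e) (sndV e) * x (fstV e) (fstO f) * x (fstV e) (sndO f) -
        ε (sndV e) * x (fstV e) (sndV e) * x (sndV e) (fstO f) * x (sndV e) (sndO f) =
      -(x (fstV e) (sndV e) ^ 2 - ε (fstV e) * ε (sndV e)) * matS ε L e f := by
    intro hef
    fin_cases e <;> fin_cases f <;>
    first
    | exact absurd rfl hef
    | (simp only [matS, fstV, sndV, fstO, sndO, Fin.mk_zero, Fin.mk_one, Fin.reduceFinMk, of_apply,
        cons_val]
       simp only [hd, hx 1 0, hx 2 0, hx 3 0, hx 2 1, hx 3 1, hx 3 2, h' 0 1 (by decide),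
        h' 0 2 (by decide), h' 0 3 (by decide), h' 1 2 (by decide), h' 1 3 (by decide),
        h' 2 3 (by decide)]
       grind)
  by_cases hef : e = f
  · subst hef
    fin_cases e
    · exact w0.symm
    · exact w1.symm
    · exact w2.symm
    · exact w3.symm
    · exact w4.symm
    · exact w5.symm
  · rw [hrest hef, s0]

theorem jacFormula_apply (L : Fin 6 → ℂ) (e f : Fin 6) :
    jacFormula ε a L e f = -eta ε a * (sig ε L (fstV e) (sndV e) * matS ε L e f *
      sig ε L (fstV f) (sndV f)) := by
  have hD : (![sig ε L 0 1, sig ε L 0 2, sig ε L 0 3, sig ε L 1 2, sig ε L 1 3, sig ε L 2 3] :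
      Fin 6 → ℂ) = fun e => sig ε L (fstV e) (sndV e) := by
    funext e; fin_cases e <;> rfl
  simp [jacFormula, matD, hD, mul_diagonal, diagonal_mul]

theorem hasFDerivAt_matCLM {𝕜 : Type*} [NontriviallyNormedField 𝕜] [CompleteSpace 𝕜]
    {F : (Fin 6 → 𝕜) → (Fin 6 → 𝕜)} {p : Fin 6 → 𝕜} {M : Matrix (Fin 6) (Fin 6) 𝕜}
    (hF : DifferentiableAt 𝕜 F p) (h : ∀ e f, fderiv 𝕜 F p (Pi.single f 1) e = M e f) :
    HasFDerivAt F (matCLM M) p := by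
  convert hF.hasFDerivAt using 1
  apply ContinuousLinearMap.coe_injective
  refine (Pi.basisFun 𝕜 (Fin 6)).ext fun f => funext fun e => ?_
  simp [matCLM, h]

/-- The dual Jacobian formula for the lengths as functions of the dihedral angles. -/
theorem Regular.lengthFun_hasFDerivAt (h : Regular ε a) (hε : ∀ k, ε k ^ 2 = 1)
    (hη : eta ε a * rootDet a ^ 3 = ∏ k, rootCof ε a k) (hne : ∀ e, sigFun ε a e ≠ 0) :
    HasFDerivAt (lengthFun ε) (matCLM (jacFormula ε a (lengthFun ε a))) a := by
  refine hasFDerivAt_matCLM h.lengthFun_analyticAt.differentiableAt fun e f => ?_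
  refine mul_right_cancel₀ (hne e) ?_
  have hsig := h.sig_lengthFun hε
  rw [h.lengthFun_fderiv_mul hε, h.normCof_fderiv hε, jacFormula_apply,
    matS_entry (normCof_comm ε a) (h.normCof_self hε) hε (h.sig'_lengthFun hε)
      (fun e => by rw [hsig]; exact h.normCof_sq_sub hε e) (fun e => by rw [hsig]; exact hne e),
    hsig, hsig]
  -- The four vertices are the ends of `f` and of its opposite edge. Hence `sin (a f)` with its
  -- factor from `Regular.normCof_fderiv` equals `η σ_f`.
  have hp : ∏ k, rootCof ε a k = rootCof ε a (fstO f) * rootCof ε a (sndO f) *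
      (rootCof ε a (fstV f) * rootCof ε a (sndV f)) := by
    rw [Fin.prod_univ_four]
    fin_cases f <;> simp [fstO, sndO, fstV, sndV] <;> ring
  rw [hp] at hη
  have h1 := h.rootCof_ne_zero (fstV f)
  have h2 := h.rootCof_ne_zero (sndV f)
  have h3 := h.rootDet_ne_zero
  rw [sigFun.eq_1 ε a f]
  field_simp
  linear_combination (-Complex.sin (a f) * sigFun ε a e ^ 2 * matS ε (lengthFun ε a) e f) * -hη

end

end DualJacobian
end

/-! ### Lorentzian geometry of a doubly truncated tetrahedron. -/

noncomputable section

namespace DualJacobian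

open Matrix

theorem mink_comm (x y : Fin 4 → ℝ) : mink x y = mink y x := by simp only [mink]; ring

theorem mink_smul_smul (s t : ℝ) (x y : Fin 4 → ℝ) : mink (s • x) (t • y) = s * t * mink x y := by
  simp only [mink, Pi.smul_apply, smul_eq_mul]; ring

theorem hdist_normalise (x y : Fin 4 → ℝ) : hdist (normalise x) (normalise y) =
    Real.arcosh (-mink x y / (Real.sqrt (-mink x x) * Real.sqrt (-mink y y))) := by
  rw [hdist, normalise, normalise, mink_smul_smul]
  congr 1
  field_simp

theorem hdist_normalise_left (x y : Fin 4 → ℝ) :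
    hdist (normalise x) y = Real.arcosh (-mink x y / Real.sqrt (-mink x x)) := by
  have h := mink_smul_smul (Real.sqrt (-mink x x))⁻¹ 1 x y
  rw [one_smul] at h
  rw [hdist, normalise, h]
  congr 1
  field_simp

/-- The strict reversed Cauchy-Schwarz inequality on the hyperboloid. -/
theorem mink_lt_neg_one {x y : Fin 4 → ℝ} (hx : mink x x = -1) (hx0 : 0 < x 0)
    (hy : mink y y = -1) (hy0 : 0 < y 0) (hne : x ≠ y) : mink x y < -1 := by
  simp only [mink] at *
  -- Lagrange's identity for the vectors `(1, x 1, x 2, x 3)` and `(1, y 1, y 2, y 3)`.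
  have key : (1 + x 1 * y 1 + x 2 * y 2 + x 3 * y 3) ^ 2 + ((x 1 - y 1) ^ 2 + (x 2 - y 2) ^ 2 +
      (x 3 - y 3) ^ 2 + (x 1 * y 2 - x 2 * y 1) ^ 2 + (x 1 * y 3 - x 3 * y 1) ^ 2 +
      (x 2 * y 3 - x 3 * y 2) ^ 2) = (x 0 * y 0) ^ 2 := by
    have e1 : x 0 ^ 2 = 1 + x 1 ^ 2 + x 2 ^ 2 + x 3 ^ 2 := by linarith
    have e2 : y 0 ^ 2 = 1 + y 1 ^ 2 + y 2 ^ 2 + y 3 ^ 2 := by linarith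
    rw [mul_pow, e1, e2]; ring
  have q1 := sq_nonneg (x 1 - y 1)
  have q2 := sq_nonneg (x 2 - y 2)
  have q3 := sq_nonneg (x 3 - y 3)
  have hpos : 0 < (x 1 - y 1) ^ 2 + (x 2 - y 2) ^ 2 + (x 3 - y 3) ^ 2 := by
    by_contra hcon
    have h1 : x 1 = y 1 := sub_eq_zero.1 (pow_eq_zero_iff two_ne_zero |>.1 (by linarith))
    have h2 : x 2 = y 2 := sub_eq_zero.1 (pow_eq_zero_iff two_ne_zero |>.1 (by linarith))
    have h3 : x 3 = y 3 := sub_eq_zero.1 (pow_eq_zero_iff two_ne_zero |>.1 (by linarith))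
    have h0 : x 0 = y 0 := by
      rw [h1, h2, h3] at hx
      refine (mul_self_inj hx0.le hy0.le).1 ?_
      linarith
    refine hne (funext fun i => ?_)
    fin_cases i
    · exact h0
    · exact h1
    · exact h2
    · exact h3
  have hlt : 1 + x 1 * y 1 + x 2 * y 2 + x 3 * y 3 < x 0 * y 0 := by
    refine lt_of_pow_lt_pow_left₀ 2 (by positivity) ?_
    linarith [sq_nonneg (x 1 * y 2 - x 2 * y 1), sq_nonneg (x 1 * y 3 - x 3 * y 1),
      sq_nonneg (x 2 * y 3 - x 3 * y 2)]
  linarith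

/-- The matrix of the Lorentzian inner product. -/
def minkMat : Matrix (Fin 4) (Fin 4) ℝ := diagonal ![-1, 1, 1, 1]

theorem mul_minkMat_mul (x y : Fin 4 → Fin 4 → ℝ) :
    of x * minkMat * (of y)ᵀ = of fun i j => mink (x i) (y j) := by
  ext i j
  rw [mul_apply, Fin.sum_univ_four]
  simp [minkMat, mul_diagonal, mink]

theorem minkMat_mul_self : minkMat * minkMat = 1 := by
  rw [minkMat, diagonal_mul_diagonal, ← diagonal_one]
  congr 1
  funext i
  fin_cases i <;> simp

/-- Jacobi's identity for the complementary minors of a real Gram matrix. -/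
theorem adjugate_sq_sub (G : Matrix (Fin 4) (Fin 4) ℝ) (hs : ∀ i j, G i j = G j i)
    (h1 : ∀ i, G i i = 1) (e : Fin 6) :
    G.adjugate (fstV e) (sndV e) ^ 2 -
      G.adjugate (fstV e) (fstV e) * G.adjugate (sndV e) (sndV e) =
      -G.det * (1 - G (fstO e) (sndO e) ^ 2) := by
  -- Complex cosine is surjective, so every real symmetric matrix with unit diagonal is `gram a` for
  -- some complex `a`, and the complex identity applies.
  choose a ha using fun e : Fin 6 => Complex.cos_surjective (-(G (fstO e) (sndO e)) : ℂ)
  have hg : gram a = G.map (algebraMap ℝ ℂ) := by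
    ext i j
    fin_cases i <;> fin_cases j <;>
      simp [gram, ha, fstO, sndO, h1, hs 1 0, hs 2 0, hs 3 0, hs 2 1, hs 3 1, hs 3 2]
  have h := cof_sq_sub a e
  have hdet : (G.map (algebraMap ℝ ℂ)).det = algebraMap ℝ ℂ G.det :=
    ((algebraMap ℝ ℂ).map_det G).symm
  have hadj : (G.map (algebraMap ℝ ℂ)).adjugate = G.adjugate.map (algebraMap ℝ ℂ) :=
    ((algebraMap ℝ ℂ).map_adjugate G).symm
  rw [Complex.sin_sq, ha, cof, hg, hdet, hadj] at h
  simp only [map_apply, Complex.coe_algebraMap] at h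
  have h2 := congrArg Complex.re h
  norm_cast at h2
  rw [h2]; ring

namespace DoublyTruncated

variable (T : DoublyTruncated)

/-- The Gram matrix of the normals. -/
def gramN : Matrix (Fin 4) (Fin 4) ℝ := of fun i j => mink (T.n i) (T.n j)

/-- The product of a normal with the vertex opposite to its face. -/
def ht (i : Fin 4) : ℝ := mink (T.n i) (T.v i)

theorem ht_neg (i : Fin 4) : T.ht i < 0 := T.normal_outer i

theorem ht_ne_zero (i : Fin 4) : T.ht i ≠ 0 := (T.ht_neg i).ne

theorem gramN_comm (i j : Fin 4) : T.gramN i j = T.gramN j i := mink_comm _ _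

theorem gramN_self (i : Fin 4) : T.gramN i i = 1 := T.normal_unit i

theorem normals_mul_vertices :
    of T.n * (minkMat * (of T.v)ᵀ * diagonal fun i => (T.ht i)⁻¹) = 1 := by
  rw [← Matrix.mul_assoc, ← Matrix.mul_assoc, mul_minkMat_mul]
  ext i j
  rw [mul_diagonal, of_apply]
  by_cases h : i = j
  · subst h
    rw [one_apply_eq]
    exact mul_inv_cancel₀ (T.ht_ne_zero i)
  · rw [one_apply_ne h, T.normal_orth i j h, zero_mul]

/-- The vectors `v j / ht j` are the basis dual to the normals, and Gram matrices of dual bases are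
inverse to each other. -/
theorem gramN_mul : T.gramN * (of fun j k => mink (T.v j) (T.v k) / (T.ht j * T.ht k)) = 1 := by
  set K := minkMat * (of T.v)ᵀ * diagonal fun i => (T.ht i)⁻¹ with hK
  have h1 : of T.n * K = 1 := T.normals_mul_vertices
  have h2 : K * of T.n = 1 := mul_eq_one_comm.1 h1
  have hJ : minkMatᵀ = minkMat := diagonal_transpose _
  have h3 : (of fun j k => mink (T.v j) (T.v k) / (T.ht j * T.ht k)) = Kᵀ * minkMat * K := by
    have : Kᵀ * minkMat * K = (diagonal fun i => (T.ht i)⁻¹) * (of T.v * minkMat * (of T.v)ᵀ) *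
        diagonal fun i => (T.ht i)⁻¹ := by
      rw [hK]
      simp only [transpose_mul, diagonal_transpose, transpose_transpose, hJ]
      calc _ = (diagonal fun i => (T.ht i)⁻¹) * (of T.v * (minkMat * (minkMat * minkMat)) *
            (of T.v)ᵀ) * diagonal fun i => (T.ht i)⁻¹ := by simp only [Matrix.mul_assoc]
        _ = _ := by rw [minkMat_mul_self, Matrix.mul_one]
    rw [this, mul_minkMat_mul]
    ext j k
    rw [mul_diagonal, diagonal_mul, of_apply, of_apply]
    field_simp
  have h4 : T.gramN = of T.n * minkMat * (of T.n)ᵀ := (mul_minkMat_mul _ _).symm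
  rw [h3, h4]
  calc _ = of T.n * (minkMat * ((K * of T.n)ᵀ * minkMat)) * K := by
        simp only [transpose_mul, Matrix.mul_assoc]
    _ = 1 := by rw [h2, transpose_one, Matrix.one_mul, minkMat_mul_self, Matrix.mul_one, h1]

theorem normals_det_ne_zero : (of T.n).det ≠ 0 := by
  intro h
  have := congrArg det T.normals_mul_vertices
  rw [det_mul, h, zero_mul, det_one] at this
  exact zero_ne_one this

theorem gramN_det_neg : T.gramN.det < 0 := by
  have h4 : T.gramN = of T.n * minkMat * (of T.n)ᵀ := (mul_minkMat_mul _ _).symm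
  have h5 := T.normals_det_ne_zero
  have h6 : minkMat.det = -1 := by simp [minkMat, det_diagonal, Fin.prod_univ_four]
  rw [h4, det_mul, det_mul, det_transpose, h6]
  have := sq_pos_of_ne_zero h5
  linarith

theorem gramN_adjugate (k l : Fin 4) : T.gramN.adjugate k l =
    T.gramN.det * (mink (T.v k) (T.v l) / (T.ht k * T.ht l)) := by
  have h : T.gramN.adjugate = T.gramN.det •
      (of fun j k => mink (T.v j) (T.v k) / (T.ht j * T.ht k)) := by
    have := congrArg (T.gramN.adjugate * ·) T.gramN_mul
    simp only [← Matrix.mul_assoc, adjugate_mul, Matrix.mul_one, smul_mul, Matrix.one_mul] at this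
    exact this.symm
  rw [h]; rfl

theorem one_sub_gramN_sq (e : Fin 6) : 1 - T.gramN (fstO e) (sndO e) ^ 2 =
    -T.gramN.det * (mink (T.v (fstV e)) (T.v (sndV e)) ^ 2 -
      mink (T.v (fstV e)) (T.v (fstV e)) * mink (T.v (sndV e)) (T.v (sndV e))) /
      (T.ht (fstV e) * T.ht (sndV e)) ^ 2 := by
  have h := adjugate_sq_sub T.gramN T.gramN_comm T.gramN_self e
  simp only [gramN_adjugate] at h
  have h1 := T.ht_ne_zero (fstV e)
  have h2 := T.ht_ne_zero (sndV e)
  refine mul_left_cancel₀ (neg_ne_zero.2 T.gramN_det_neg.ne) ?_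
  rw [← h]
  field_simp

/-- The signs `ε`, as real numbers. -/
def sgn : Fin 4 → ℝ := ![-1, -1, 1, 1]

theorem ofReal_sgn (k : Fin 4) : ((sgn k : ℝ) : ℂ) = epsDT k := by
  fin_cases k <;> simp [sgn, epsDT]

theorem mink_self (k : Fin 4) : mink (T.v k) (T.v k) = -sgn k := by
  fin_cases k
  · simpa [sgn] using T.ultra 0 (by decide)
  · simpa [sgn] using T.ultra 1 (by decide)
  · simpa [sgn] using (T.proper 2 (by decide)).1
  · simpa [sgn] using (T.proper 3 (by decide)).1

theorem sgn_sq (k : Fin 4) : sgn k ^ 2 = 1 := by fin_cases k <;> simp [sgn]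

theorem mink_two_three : mink (T.v 2) (T.v 3) < -1 := by
  obtain ⟨h1, h2⟩ := T.proper 2 (by decide)
  obtain ⟨h3, h4⟩ := T.proper 3 (by decide)
  refine mink_lt_neg_one h1 h2 h3 h4 fun h => ?_
  have h5 := T.normal_outer 2
  rw [h, T.normal_orth 2 3 (by decide)] at h5
  exact lt_irrefl _ h5

theorem mink_edge_neg (e : Fin 6) (he : e ≠ 0) : mink (T.v (fstV e)) (T.v (sndV e)) < 0 := by
  fin_cases e
  · exact absurd rfl he
  · exact T.kept 0 2 (by decide) (by decide)
  · exact T.kept 0 3 (by decide) (by decide)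
  · exact T.kept 1 2 (by decide) (by decide)
  · exact T.kept 1 3 (by decide) (by decide)
  · exact T.mink_two_three.trans (by norm_num)

theorem mink_edge_sq (e : Fin 6) (he : e ≠ 0) :
    0 < mink (T.v (fstV e)) (T.v (sndV e)) ^ 2 - sgn (fstV e) * sgn (sndV e) := by
  fin_cases e
  · exact absurd rfl he
  · simp [fstV, sndV, sgn]; positivity
  · simp [fstV, sndV, sgn]; positivity
  · simp [fstV, sndV, sgn]; positivity
  · simp [fstV, sndV, sgn]; positivity
  · have := T.mink_two_three
    change 0 < mink (T.v 2) (T.v 3) ^ 2 - 1 * 1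
    nlinarith

/-- `Real.arccos` clamps its argument, so `dihedral` determines the Gram entry only if that entry
lies in `[-1, 1]`. The bound follows from Jacobi's identity and `det G < 0`. -/
theorem gramN_edge_sq_lt (e : Fin 6)
    (he : 0 < mink (T.v (fstV e)) (T.v (sndV e)) ^ 2 - sgn (fstV e) * sgn (sndV e)) :
    T.gramN (fstO e) (sndO e) ^ 2 < 1 := by
  have h := T.one_sub_gramN_sq e
  rw [mink_self, mink_self, neg_mul_neg] at h
  have : 0 < 1 - T.gramN (fstO e) (sndO e) ^ 2 := by
    rw [h]
    have h1 := T.ht_ne_zero (fstV e)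
    have h2 := T.ht_ne_zero (sndV e)
    have h3 := neg_pos.2 T.gramN_det_neg
    positivity
  linarith

theorem cos_dihedral {i j : Fin 4} (h : T.gramN i j ^ 2 ≤ 1) :
    Real.cos (T.dihedral i j) = -T.gramN i j := by
  have := abs_le.1 (sq_le_one_iff_abs_le_one _ |>.1 h)
  exact Real.cos_arccos (by change -1 ≤ -T.gramN i j; linarith)
    (by change -T.gramN i j ≤ 1; linarith)

theorem dihedral_mem {i j : Fin 4} (h : T.gramN i j ^ 2 < 1) :
    T.dihedral i j ∈ Set.Ioo 0 Real.pi := by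
  have := abs_lt.1 (sq_lt_one_iff_abs_lt_one _ |>.1 h)
  refine ⟨Real.arccos_pos.2 ?_, lt_of_le_of_ne (Real.arccos_le_pi _) fun h => ?_⟩
  · change -T.gramN i j < 1; linarith
  · have := Real.arccos_eq_pi.1 h
    change -T.gramN i j ≤ -1 at this
    linarith

/-- The square of the timelike component of `v j` orthogonal to `v 0`, `v 1`, times
`1 - ⟨v 0, v 1⟩ ^ 2`. -/
def ridgeSq (j : Fin 4) : ℝ :=
  mink (T.v 0) (T.v 1) ^ 2 - 1 -
    mink (T.v 0) (T.v j) * (mink (T.v 0) (T.v j) - mink (T.v 0) (T.v 1) * mink (T.v 1) (T.v j)) -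
    mink (T.v 1) (T.v j) * (mink (T.v 1) (T.v j) - mink (T.v 0) (T.v 1) * mink (T.v 0) (T.v j))

/-- The product of the components of `v 2` and `v 3` orthogonal to `v 0`, `v 1`, times
`1 - ⟨v 0, v 1⟩ ^ 2`. -/
def ridgeMul : ℝ :=
  (1 - mink (T.v 0) (T.v 1) ^ 2) * mink (T.v 2) (T.v 3) -
    mink (T.v 0) (T.v 2) * (mink (T.v 0) (T.v 3) - mink (T.v 0) (T.v 1) * mink (T.v 1) (T.v 3)) -
    mink (T.v 1) (T.v 2) * (mink (T.v 1) (T.v 3) - mink (T.v 0) (T.v 1) * mink (T.v 0) (T.v 3))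

theorem gramN_row (i k : Fin 4) : ∑ j, T.gramN i j * mink (T.v j) (T.v k) / T.ht j =
    if i = k then T.ht i else 0 := by
  have h := congrFun (congrFun T.gramN_mul i) k
  rw [mul_apply] at h
  have h2 : ∑ j, T.gramN i j * mink (T.v j) (T.v k) / T.ht j = T.ht k *
      ∑ j, T.gramN i j * (of fun j k => mink (T.v j) (T.v k) / (T.ht j * T.ht k)) j k := by
    rw [Finset.mul_sum]
    refine Finset.sum_congr rfl fun j _ => ?_
    have := T.ht_ne_zero j
    have := T.ht_ne_zero k
    rw [of_apply]; field_simp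
  rw [h2, h, one_apply]
  split_ifs with hik
  · rw [hik, mul_one]
  · rw [mul_zero]

/-- The normals `n 2`, `n 3` span the orthogonal complement of `v 0`, `v 1`, so expanding them in
the vertices involves only the projections of `v 2`, `v 3` to that plane. The relations compare the
two Gram matrices there. Being multiplied by `1 - ⟨v 0, v 1⟩²`, they survive in the tangent case. -/
theorem ridge_relations :
    T.gramN 2 3 * T.ridgeSq 2 * T.ht 3 = -T.ridgeMul * T.ht 2 ∧
    T.ridgeSq 2 * (1 - T.gramN 2 3 ^ 2) = (1 - mink (T.v 0) (T.v 1) ^ 2) * T.ht 2 ^ 2 ∧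
    T.ridgeSq 3 * (1 - T.gramN 2 3 ^ 2) = (1 - mink (T.v 0) (T.v 1) ^ 2) * T.ht 3 ^ 2 := by
  have m0 : mink (T.v 0) (T.v 0) = 1 := T.ultra 0 (by decide)
  have m1 : mink (T.v 1) (T.v 1) = 1 := T.ultra 1 (by decide)
  have m2 : mink (T.v 2) (T.v 2) = -1 := (T.proper 2 (by decide)).1
  have m3 : mink (T.v 3) (T.v 3) = -1 := (T.proper 3 (by decide)).1
  have r (i k : Fin 4) := T.gramN_row i k
  simp only [Fin.sum_univ_four, mul_div_right_comm] at r
  have h2 := T.ht_ne_zero 2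
  have h3 := T.ht_ne_zero 3
  set y := fun i j => T.gramN i j / T.ht j with hy
  have g22 : y 2 2 * T.ht 2 = 1 := by simp only [hy, T.gramN_self]; field_simp
  have g33 : y 3 3 * T.ht 3 = 1 := by simp only [hy, T.gramN_self]; field_simp
  have g23 : y 2 3 * T.ht 3 = T.gramN 2 3 := by simp only [hy]; field_simp
  have g32 : y 3 2 * T.ht 2 = T.gramN 2 3 := by simp only [hy, T.gramN_comm 3 2]; field_simp
  change ∀ i k, y i 0 * _ + y i 1 * _ + y i 2 * _ + y i 3 * _ = _ at r
  have e20 := r 2 0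
  have e21 := r 2 1
  have e22 := r 2 2
  have e23 := r 2 3
  have e30 := r 3 0
  have e31 := r 3 1
  have e32 := r 3 2
  have e33 := r 3 3
  simp only [m0, m1, m2, m3, mink_comm (T.v 1) (T.v 0), mink_comm (T.v 2) (T.v 0),
    mink_comm (T.v 3) (T.v 0), mink_comm (T.v 2) (T.v 1), mink_comm (T.v 3) (T.v 1),
    mink_comm (T.v 3) (T.v 2), Fin.reduceEq, if_true, if_false] at e20 e21 e22 e23 e30 e31 e32 e33
  set c := mink (T.v 0) (T.v 1)
  set s2 := mink (T.v 0) (T.v 2)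
  set s3 := mink (T.v 0) (T.v 3)
  set t2 := mink (T.v 1) (T.v 2)
  set t3 := mink (T.v 1) (T.v 3)
  set w := mink (T.v 2) (T.v 3)
  have hA2 : T.ridgeSq 2 = c ^ 2 - 1 - s2 * (s2 - c * t2) - t2 * (t2 - c * s2) := rfl
  have hA3 : T.ridgeSq 3 = c ^ 2 - 1 - s3 * (s3 - c * t3) - t3 * (t3 - c * s3) := rfl
  have hB : T.ridgeMul = (1 - c ^ 2) * w - s2 * (s3 - c * t3) - t2 * (t3 - c * s3) := rfl
  -- Columns 0 and 1 of the expansion serve to eliminate the coefficients of `v 0` and `v 1`.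
  have f22 : y 2 2 * T.ridgeSq 2 + y 2 3 * T.ridgeMul = (1 - c ^ 2) * T.ht 2 := by
    rw [hA2, hB]
    linear_combination (1 - c ^ 2) * e22 - (s2 - c * t2) * e20 - (t2 - c * s2) * e21
  have f23 : y 2 2 * T.ridgeMul + y 2 3 * T.ridgeSq 3 = 0 := by
    rw [hA3, hB]
    linear_combination (1 - c ^ 2) * e23 - (s3 - c * t3) * e20 - (t3 - c * s3) * e21
  have f32 : y 3 2 * T.ridgeSq 2 + y 3 3 * T.ridgeMul = 0 := by
    rw [hA2, hB]
    linear_combination (1 - c ^ 2) * e32 - (s2 - c * t2) * e30 - (t2 - c * s2) * e31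
  have f33 : y 3 2 * T.ridgeMul + y 3 3 * T.ridgeSq 3 = (1 - c ^ 2) * T.ht 3 := by
    rw [hA3, hB]
    linear_combination (1 - c ^ 2) * e33 - (s3 - c * t3) * e30 - (t3 - c * s3) * e31
  have p1 : T.gramN 2 3 * T.ridgeSq 2 * T.ht 3 = -T.ridgeMul * T.ht 2 := by
    linear_combination T.ht 2 * T.ht 3 * f32 - T.ridgeMul * T.ht 2 * g33 -
      T.ridgeSq 2 * T.ht 3 * g32
  have p2 : T.gramN 2 3 * T.ridgeSq 3 * T.ht 2 = -T.ridgeMul * T.ht 3 := by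
    linear_combination T.ht 2 * T.ht 3 * f23 - T.ridgeMul * T.ht 3 * g22 -
      T.ridgeSq 3 * T.ht 2 * g23
  refine ⟨p1, ?_, ?_⟩
  · refine mul_left_cancel₀ h3 ?_
    linear_combination T.ht 2 * T.ht 3 * f22 - T.ridgeSq 2 * T.ht 3 * g22 -
      T.ridgeMul * T.ht 2 * g23 - T.gramN 2 3 * p1
  · refine mul_left_cancel₀ h2 ?_
    linear_combination T.ht 2 * T.ht 3 * f33 - T.ridgeSq 3 * T.ht 2 * g33 -
      T.ridgeMul * T.ht 3 * g32 - T.gramN 2 3 * p2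

theorem cut_vertex (i k j : Fin 4) (hi : i < 2) (hk : k < 2) (hik : i ≠ k) (hj : 2 ≤ j) :
    mink (T.v k) (T.v j) - mink (T.v 0) (T.v 1) * mink (T.v i) (T.v j) < 0 := by
  have h := T.cut i k j hi hk hik hj
  have h1 : mink (T.v j - mink (T.v i) (T.v j) • T.v i) (T.v k) =
      mink (T.v k) (T.v j) - mink (T.v i) (T.v k) * mink (T.v i) (T.v j) := by
    simp only [mink, Pi.sub_apply, Pi.smul_apply, smul_eq_mul]; ring
  have h2 : mink (T.v i) (T.v k) = mink (T.v 0) (T.v 1) := by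
    have := mink_comm (T.v 0) (T.v 1)
    fin_cases i <;> fin_cases k <;>
      first
      | rfl
      | exact this.symm
      | exact absurd rfl hik
      | exact absurd hi (by decide)
      | exact absurd hk (by decide)
  rwa [h1, h2] at h

/-- If the truncating planes are not ultraparallel, the normals of the faces opposite to the
proper vertices span no spacelike plane and point away from each other. -/
theorem gramN_two_three_le (h : mink (T.v 0) (T.v 1) ^ 2 ≤ 1) : T.gramN 2 3 ≤ -1 ∧
    T.ridgeSq 2 < 0 ∧ T.ridgeSq 3 < 0 := by
  obtain ⟨p1, p2, p3⟩ := T.ridge_relations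
  have a2 := T.cut_vertex 0 1 2 (by decide) (by decide) (by decide) (by decide)
  have b2 := T.cut_vertex 1 0 2 (by decide) (by decide) (by decide) (by decide)
  have a3 := T.cut_vertex 0 1 3 (by decide) (by decide) (by decide) (by decide)
  have b3 := T.cut_vertex 1 0 3 (by decide) (by decide) (by decide) (by decide)
  have s2 := T.kept 0 2 (by decide) (by decide)
  have t2 := T.kept 1 2 (by decide) (by decide)
  have s3 := T.kept 0 3 (by decide) (by decide)
  have t3 := T.kept 1 3 (by decide) (by decide)
  have w := T.mink_two_three
  -- The conditions `kept` and `cut` give the signs of all products here; without `cut` the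
  -- projection need not be timelike.
  have hA2 : T.ridgeSq 2 < 0 := by
    simp only [ridgeSq]
    nlinarith [mul_pos_of_neg_of_neg s2 b2, mul_pos_of_neg_of_neg t2 a2]
  have hA3 : T.ridgeSq 3 < 0 := by
    simp only [ridgeSq]
    nlinarith [mul_pos_of_neg_of_neg s3 b3, mul_pos_of_neg_of_neg t3 a3]
  have hB : T.ridgeMul < 0 := by
    simp only [ridgeMul]
    nlinarith [mul_pos_of_neg_of_neg s2 b3, mul_pos_of_neg_of_neg t2 a3]
  refine ⟨?_, hA2, hA3⟩
  have h2 := T.ht_neg 2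
  have h3 := T.ht_neg 3
  have hG : T.gramN 2 3 < 0 := by
    by_contra hcon
    push Not at hcon
    have := mul_nonneg hcon (mul_pos_of_neg_of_neg hA2 h3).le
    have := mul_pos_of_neg_of_neg hB h2
    nlinarith
  have hsq : 1 - T.gramN 2 3 ^ 2 ≤ 0 := by
    by_contra hcon
    push Not at hcon
    have := mul_neg_of_neg_of_pos hA2 hcon
    have : 0 ≤ (1 - mink (T.v 0) (T.v 1) ^ 2) * T.ht 2 ^ 2 :=
      mul_nonneg (by linarith) (sq_nonneg _)
    linarith
  nlinarith

theorem gramN_two_three_lt (h : T.IsPrism) : T.gramN 2 3 < -1 := by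
  have h1 : mink (T.v 0) (T.v 1) ^ 2 < 1 := (sq_lt_one_iff_abs_lt_one _).2 h
  obtain ⟨h2, h3, -⟩ := T.gramN_two_three_le h1.le
  refine lt_of_le_of_ne h2 fun h4 => ?_
  have h5 := T.ridge_relations.2.1
  rw [h4] at h5
  have := T.ht_ne_zero 2
  have h6 : 0 < (1 - mink (T.v 0) (T.v 1) ^ 2) * T.ht 2 ^ 2 :=
    mul_pos (by linarith) (by positivity)
  linarith

theorem gramN_two_three_eq (h : T.IsTangent) : T.gramN 2 3 = -1 := by
  have h0 : mink (T.v 0) (T.v 1) = -1 := h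
  have h1 : mink (T.v 0) (T.v 1) ^ 2 ≤ 1 := by rw [h0]; norm_num
  obtain ⟨h2, h3, -⟩ := T.gramN_two_three_le h1
  have h5 := T.ridge_relations.2.1
  rw [h0] at h5
  norm_num at h5
  rcases h5 with h5 | h5
  · exact absurd h5 h3.ne
  · nlinarith

/-- The faces opposite to `v 2` and `v 3` are both orthogonal to the ridge, which is therefore their
common perpendicular. -/
theorem ridgeLength_eq (h : T.IsPrism) : T.ridgeLength = Real.arcosh (-T.gramN 2 3) := by
  have h1 : mink (T.v 0) (T.v 1) ^ 2 < 1 := (sq_lt_one_iff_abs_lt_one _).2 h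
  obtain ⟨-, hA2, hA3⟩ := T.gramN_two_three_le h1.le
  have hG := T.gramN_two_three_lt h
  obtain ⟨p1, p2, p3⟩ := T.ridge_relations
  have h2 := T.ht_neg 2
  have h3 := T.ht_neg 3
  have m0 : mink (T.v 0) (T.v 0) = 1 := T.ultra 0 (by decide)
  have m1 : mink (T.v 1) (T.v 1) = 1 := T.ultra 1 (by decide)
  have m2 : mink (T.v 2) (T.v 2) = -1 := (T.proper 2 (by decide)).1
  have m3 : mink (T.v 3) (T.v 3) = -1 := (T.proper 3 (by decide)).1
  have hne : 1 - mink (T.v 0) (T.v 1) ^ 2 ≠ 0 := by linarith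
  have expand (x y u v : Fin 4 → ℝ) (a b a' b' : ℝ) :
      mink (x - a • u - b • v) (y - a' • u - b' • v) = mink x y - a' * mink u x - b' * mink v x -
        a * mink u y - b * mink v y + a * a' * mink u u + b * b' * mink v v +
        (a * b' + a' * b) * mink u v := by
    simp only [mink, Pi.sub_apply, Pi.smul_apply, smul_eq_mul]; ring
  have q2 : -(T.ridgeSq 2) / (1 - mink (T.v 0) (T.v 1) ^ 2) =
      (-T.ht 2) ^ 2 / (T.gramN 2 3 ^ 2 - 1) := by
    have : T.gramN 2 3 ^ 2 - 1 ≠ 0 := by nlinarith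
    field_simp
    linarith
  have q3 : -(T.ridgeSq 3) / (1 - mink (T.v 0) (T.v 1) ^ 2) =
      (-T.ht 3) ^ 2 / (T.gramN 2 3 ^ 2 - 1) := by
    have : T.gramN 2 3 ^ 2 - 1 ≠ 0 := by nlinarith
    field_simp
    linarith
  have hpos : 0 < T.gramN 2 3 ^ 2 - 1 := by nlinarith
  have hs : Real.sqrt (T.gramN 2 3 ^ 2 - 1) ^ 2 = T.gramN 2 3 ^ 2 - 1 := Real.sq_sqrt hpos.le
  have hs0 := Real.sqrt_pos.2 hpos
  have n2 : Real.sqrt (-(T.ridgeSq 2) / (1 - mink (T.v 0) (T.v 1) ^ 2)) =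
      -T.ht 2 / Real.sqrt (T.gramN 2 3 ^ 2 - 1) := by
    rw [q2, Real.sqrt_div (sq_nonneg _), Real.sqrt_sq (by linarith)]
  have n3 : Real.sqrt (-(T.ridgeSq 3) / (1 - mink (T.v 0) (T.v 1) ^ 2)) =
      -T.ht 3 / Real.sqrt (T.gramN 2 3 ^ 2 - 1) := by
    rw [q3, Real.sqrt_div (sq_nonneg _), Real.sqrt_sq (by linarith)]
  rw [ridgeLength, ridgeEnd, ridgeEnd, hdist_normalise]
  simp only [expand, m0, m1, m2, m3]
  convert_to Real.arcosh (-T.ridgeMul / (1 - mink (T.v 0) (T.v 1) ^ 2) /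
    (Real.sqrt (-(T.ridgeSq 2) / (1 - mink (T.v 0) (T.v 1) ^ 2)) *
      Real.sqrt (-(T.ridgeSq 3) / (1 - mink (T.v 0) (T.v 1) ^ 2)))) = _ using 5
  · rw [ridgeMul]
    field_simp
    ring
  · rw [ridgeSq]
    field_simp
    ring
  · rw [ridgeSq]
    field_simp
    ring
  · rw [n2, n3]
    congr 1
    have h4 := T.ht_ne_zero 2
    have h5 := T.ht_ne_zero 3
    field_simp
    rw [hs]
    refine mul_left_cancel₀ h4 ?_
    linear_combination (T.gramN 2 3 ^ 2 - 1) * (-p1) + T.gramN 2 3 * T.ht 3 * (-p2)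

end DoublyTruncated

end DualJacobian
end

/-! ### Values of the length function on the three kinds of tetrahedra. -/

noncomputable section

namespace DualJacobian

open Matrix

theorem epsDT_sq (k : Fin 4) : epsDT k ^ 2 = 1 := by fin_cases k <;> simp [epsDT]

theorem cpow_half_ofReal {x : ℝ} (hx : 0 ≤ x) : (x : ℂ) ^ (1 / 2 : ℂ) = (Real.sqrt x : ℝ) := by
  rw [Real.sqrt_eq_rpow, Complex.ofReal_cpow hx]
  norm_num

namespace DoublyTruncated

variable (T : DoublyTruncated)

theorem gramN_edge_sq (e : Fin 6) (he : e ≠ 0) : T.gramN (fstO e) (sndO e) ^ 2 < 1 :=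
  T.gramN_edge_sq_lt e (T.mink_edge_sq e he)

theorem angles_apply (z : ℂ) (e : Fin 6) (he : e ≠ 0) :
    T.angles z e = (T.dihedral (fstO e) (sndO e) : ℂ) := by
  fin_cases e <;> first | exact absurd rfl he | rfl

theorem lengths_apply (z : ℂ) (e : Fin 6) (he : e ≠ 0) :
    T.lengths z e = (T.edgeLength (fstV e) (sndV e) : ℂ) := by
  fin_cases e <;> first | exact absurd rfl he | rfl

section

variable {T} {z : ℂ} (hz : Complex.cos z = -(T.gramN 2 3 : ℂ))

include hz

/-- The only demand on `z` is `hz`. It is met by the dihedral angle for mild truncation, by 0 for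
tangent planes and by `iℓ` for prisms, so the computations below cover all three. -/
theorem cos_angles (e : Fin 6) :
    Complex.cos (T.angles z e) = -(T.gramN (fstO e) (sndO e) : ℂ) := by
  by_cases he : e = 0
  · subst he; exact hz
  · rw [T.angles_apply z e he, ← Complex.ofReal_cos, T.cos_dihedral (T.gramN_edge_sq e he).le,
      Complex.ofReal_neg]

theorem gram_angles : gram (T.angles z) = T.gramN.map (algebraMap ℝ ℂ) := by
  ext i j
  have hs := T.gramN_comm
  fin_cases i <;> fin_cases j <;>
    simp [gram, cos_angles hz, fstO, sndO, T.gramN_self, hs 1 0, hs 2 0, hs 3 0, hs 2 1, hs 3 1,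
      hs 3 2]

theorem gram_det_angles : (gram (T.angles z)).det = (T.gramN.det : ℂ) := by
  rw [gram_angles hz]
  exact ((algebraMap ℝ ℂ).map_det T.gramN).symm

theorem cof_angles (k l : Fin 4) : cof (T.angles z) k l =
    (T.gramN.det * (mink (T.v k) (T.v l) / (T.ht k * T.ht l)) : ℝ) := by
  rw [cof, gram_angles hz, ← T.gramN_adjugate]
  exact congrFun (congrFun ((algebraMap ℝ ℂ).map_adjugate T.gramN).symm k) l

theorem eps_mul_cof_angles (k : Fin 4) : epsDT k * cof (T.angles z) k k =
    ((Real.sqrt (-T.gramN.det) / -T.ht k) ^ 2 : ℝ) := by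
  rw [cof_angles hz, T.mink_self, ← ofReal_sgn, ← Complex.ofReal_mul, div_pow,
    Real.sq_sqrt (neg_pos.2 T.gramN_det_neg).le]
  congr 1
  have := T.ht_ne_zero k
  field_simp
  linear_combination (-T.gramN.det) * sgn_sq k

theorem rootCof_angles (k : Fin 4) : rootCof epsDT (T.angles z) k =
    (Real.sqrt (-T.gramN.det) / -T.ht k : ℝ) := by
  rw [rootCof, eps_mul_cof_angles hz, cpow_half_ofReal (sq_nonneg _), Real.sqrt_sq]
  exact div_nonneg (Real.sqrt_nonneg _) (neg_pos.2 (T.ht_neg k)).le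

theorem rootDet_angles : rootDet (T.angles z) = (Real.sqrt (-T.gramN.det) : ℝ) := by
  rw [rootDet, gram_det_angles hz, ← Complex.ofReal_neg,
    cpow_half_ofReal (neg_pos.2 T.gramN_det_neg).le]

theorem normCof_angles (k l : Fin 4) :
    normCof epsDT (T.angles z) k l = (-mink (T.v k) (T.v l) : ℝ) := by
  rw [normCof, rootCof_angles hz, rootCof_angles hz, cof_angles hz, ← Complex.ofReal_mul,
    ← Complex.ofReal_div]
  congr 1
  have h1 := T.ht_ne_zero k
  have h2 := T.ht_ne_zero l
  have h3 := Real.sqrt_pos.2 (neg_pos.2 T.gramN_det_neg)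
  have h4 := Real.sq_sqrt (neg_pos.2 T.gramN_det_neg).le
  field_simp
  rw [h4]
  ring

theorem sigFun_angles (e : Fin 6) : sigFun epsDT (T.angles z) e = Complex.sin (T.angles z e) *
    (T.ht (fstV e) * T.ht (sndV e) / Real.sqrt (-T.gramN.det) : ℝ) := by
  rw [sigFun, rootCof_angles hz, rootCof_angles hz, rootDet_angles hz, ← Complex.ofReal_mul,
    ← Complex.ofReal_div]
  congr 2
  have h1 := T.ht_ne_zero (fstV e)
  have h2 := T.ht_ne_zero (sndV e)
  have h3 := Real.sqrt_pos.2 (neg_pos.2 T.gramN_det_neg)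
  field_simp

theorem sigFun_angles_sq (e : Fin 6) : sigFun epsDT (T.angles z) e ^ 2 =
    (mink (T.v (fstV e)) (T.v (sndV e)) ^ 2 - sgn (fstV e) * sgn (sndV e) : ℝ) := by
  have h := T.one_sub_gramN_sq e
  rw [sigFun_angles hz, mul_pow, Complex.sin_sq, cos_angles hz, neg_sq, ← Complex.ofReal_pow,
    ← Complex.ofReal_one, ← Complex.ofReal_sub, ← Complex.ofReal_pow, ← Complex.ofReal_mul, h,
    T.mink_self, T.mink_self, div_pow, Real.sq_sqrt (neg_pos.2 T.gramN_det_neg).le]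
  congr 1
  have h1 := T.ht_ne_zero (fstV e)
  have h2 := T.ht_ne_zero (sndV e)
  have h3 := T.gramN_det_neg.ne
  field_simp

/-- `σ` of an edge with a real dihedral angle. -/
theorem sigFun_angles_eq_sqrt (e : Fin 6) (θ : ℝ) (hθ : T.angles z e = θ)
    (h0 : 0 ≤ Real.sin θ) : sigFun epsDT (T.angles z) e =
      (Real.sqrt (mink (T.v (fstV e)) (T.v (sndV e)) ^ 2 - sgn (fstV e) * sgn (sndV e)) : ℝ) := by
  have h := sigFun_angles_sq hz e
  rw [sigFun_angles hz, hθ, ← Complex.ofReal_sin, ← Complex.ofReal_mul] at h ⊢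
  rw [← Complex.ofReal_pow, Complex.ofReal_inj] at h
  rw [← h, Real.sqrt_sq]
  exact mul_nonneg h0 (div_nonneg (mul_pos_of_neg_of_neg (T.ht_neg _) (T.ht_neg _)).le
    (Real.sqrt_nonneg _))

theorem expLength_angles (e : Fin 6) (θ : ℝ) (hθ : T.angles z e = θ)
    (h0 : 0 ≤ Real.sin θ) : expLength epsDT (T.angles z) e =
      (-mink (T.v (fstV e)) (T.v (sndV e)) +
        Real.sqrt (mink (T.v (fstV e)) (T.v (sndV e)) ^ 2 - sgn (fstV e) * sgn (sndV e)) : ℝ) := by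
  rw [expLength, normCof_angles hz, sigFun_angles_eq_sqrt hz e θ hθ h0, Complex.ofReal_add]

omit hz in
theorem sin_dihedral_nonneg (i j : Fin 4) : 0 ≤ Real.sin (T.dihedral i j) :=
  Real.sin_nonneg_of_nonneg_of_le_pi (Real.arccos_nonneg _) (Real.arccos_le_pi _)

theorem regular_angles (h0 : expLength epsDT (T.angles z) 0 ∈ Complex.slitPlane) :
    Regular epsDT (T.angles z) where
  cof_mem k := by
    rw [eps_mul_cof_angles hz]
    refine Complex.ofReal_mem_slitPlane.2 (pow_pos ?_ 2)
    exact div_pos (Real.sqrt_pos.2 (neg_pos.2 T.gramN_det_neg)) (neg_pos.2 (T.ht_neg k))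
  det_mem := by
    rw [gram_det_angles hz, ← Complex.ofReal_neg]
    exact Complex.ofReal_mem_slitPlane.2 (neg_pos.2 T.gramN_det_neg)
  exp_mem e := by
    by_cases he : e = 0
    · rwa [he]
    · rw [expLength_angles hz e _ (T.angles_apply z e he) (sin_dihedral_nonneg _ _)]
      exact Complex.ofReal_mem_slitPlane.2
        (add_pos_of_pos_of_nonneg (neg_pos.2 (T.mink_edge_neg e he)) (Real.sqrt_nonneg _))

theorem sigFun_angles_ne_zero (hc : mink (T.v 0) (T.v 1) ^ 2 ≠ 1) (e : Fin 6) :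
    sigFun epsDT (T.angles z) e ≠ 0 := by
  refine fun h => absurd (sigFun_angles_sq hz e) ?_
  rw [h, zero_pow two_ne_zero, ← Complex.ofReal_zero, Complex.ofReal_inj]
  by_cases he : e = 0
  · subst he
    intro h1
    simp [fstV, sndV, sgn] at h1
    exact hc (by linarith)
  · exact (T.mink_edge_sq e he).ne

/-- A principal root of a quotient need not be the quotient of the principal roots. Here all
radicands are positive reals, so it is. -/
theorem eta_angles : eta epsDT (T.angles z) * rootDet (T.angles z) ^ 3 =
    ∏ k, rootCof epsDT (T.angles z) k := by
  have hm (i : Fin 4) : ((gram (T.angles z)).submatrix i.succAbove i.succAbove).det =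
      cof (T.angles z) i i := by
    rw [cof, adjugate_fin_succ_eq_det_submatrix, ← two_mul, pow_mul]
    norm_num
  have hp (k : Fin 4) : 0 < Real.sqrt (-T.gramN.det) / -T.ht k :=
    div_pos (Real.sqrt_pos.2 (neg_pos.2 T.gramN_det_neg)) (neg_pos.2 (T.ht_neg k))
  have hd := Real.sqrt_pos.2 (neg_pos.2 T.gramN_det_neg)
  have hd2 := Real.sq_sqrt (neg_pos.2 T.gramN_det_neg).le
  have key : (∏ i, epsDT i * ((gram (T.angles z)).submatrix i.succAbove i.succAbove).det) /
      (-(gram (T.angles z)).det) ^ 3 =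
      (((∏ k, (Real.sqrt (-T.gramN.det) / -T.ht k)) / Real.sqrt (-T.gramN.det) ^ 3) ^ 2 : ℝ) := by
    simp only [hm, eps_mul_cof_angles hz, gram_det_angles hz]
    rw [← Complex.ofReal_neg, ← hd2, ← Complex.ofReal_prod, ← Complex.ofReal_pow,
      ← Complex.ofReal_div, Finset.prod_pow, Real.sqrt_sq hd.le]
    congr 1
    ring
  have hpp : 0 ≤ ∏ k, (Real.sqrt (-T.gramN.det) / -T.ht k) :=
    Finset.prod_nonneg fun k _ => (hp k).le
  rw [eta, key, cpow_half_ofReal (sq_nonneg _),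
    Real.sqrt_sq (div_nonneg hpp (pow_nonneg hd.le 3)), rootDet_angles hz]
  simp only [rootCof_angles hz]
  rw [← Complex.ofReal_pow, ← Complex.ofReal_mul, ← Complex.ofReal_prod,
    div_mul_cancel₀ _ (pow_pos hd 3).ne']

end

theorem edgeLength_proper : T.edgeLength 2 3 = Real.arcosh (-mink (T.v 2) (T.v 3)) := by
  simp [edgeLength, edgeEnd, hdist]

/-- The length is the distance from `v j` to the polar plane of `v i`, whose `sinh` is `-⟨v i, v
j⟩`. -/
theorem edgeLength_mixed (i j : Fin 4) (hi : i < 2) (hj : 2 ≤ j) : T.edgeLength i j =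
    Real.arcosh (Real.sqrt (mink (T.v i) (T.v j) ^ 2 + 1)) := by
  have hj' : ¬j < 2 := not_lt.2 hj
  have hi1 := T.ultra i hi
  have hj1 := (T.proper j hj).1
  rw [edgeLength, edgeEnd, edgeEnd, if_pos hi, if_neg hj', hdist_normalise_left]
  set s := mink (T.v i) (T.v j) with hs
  have e1 : mink (T.v j - s • T.v i) (T.v j) = mink (T.v j) (T.v j) - s * mink (T.v i) (T.v j) := by
    simp only [mink, Pi.sub_apply, Pi.smul_apply, smul_eq_mul]; ring
  have e2 : mink (T.v j - s • T.v i) (T.v j - s • T.v i) = mink (T.v j) (T.v j) -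
      2 * s * mink (T.v i) (T.v j) + s ^ 2 * mink (T.v i) (T.v i) := by
    simp only [mink, Pi.sub_apply, Pi.smul_apply, smul_eq_mul]; ring
  rw [e1, e2, hi1, hj1, ← hs]
  have h : -(-1 - 2 * s * s + s ^ 2 * 1) = s ^ 2 + 1 := by ring
  have h' : -(-1 - s * s) = s ^ 2 + 1 := by ring
  rw [h, h', Real.div_sqrt]

theorem edgeLength_ultra (h : T.IsMild) :
    T.edgeLength 0 1 = Real.arcosh (-mink (T.v 0) (T.v 1)) := by
  have h0 := T.ultra 0 (by decide)
  have h1 := T.ultra 1 (by decide)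
  rw [edgeLength, edgeEnd, edgeEnd, if_pos (by decide), if_pos (by decide), hdist_normalise,
    mink_comm (T.v 1) (T.v 0)]
  have hc : mink (T.v 0) (T.v 1) < -1 := h
  set c := mink (T.v 0) (T.v 1) with hcd
  have e0 : mink (T.v 1 - c • T.v 0) (T.v 1 - c • T.v 0) = mink (T.v 1) (T.v 1) -
      2 * c * mink (T.v 0) (T.v 1) + c ^ 2 * mink (T.v 0) (T.v 0) := by
    simp only [mink, Pi.sub_apply, Pi.smul_apply, smul_eq_mul]; ring
  have e1 : mink (T.v 0 - c • T.v 1) (T.v 0 - c • T.v 1) = mink (T.v 0) (T.v 0) -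
      2 * c * mink (T.v 0) (T.v 1) + c ^ 2 * mink (T.v 1) (T.v 1) := by
    simp only [mink, Pi.sub_apply, Pi.smul_apply, smul_eq_mul]; ring
  have e2 : mink (T.v 1 - c • T.v 0) (T.v 0 - c • T.v 1) = mink (T.v 0) (T.v 1) -
      c * mink (T.v 0) (T.v 0) - c * mink (T.v 1) (T.v 1) + c ^ 2 * mink (T.v 0) (T.v 1) := by
    simp only [mink, Pi.sub_apply, Pi.smul_apply, smul_eq_mul]; ring
  rw [e0, e1, e2, h0, h1, ← hcd]
  have hp : 0 < c ^ 2 - 1 := by nlinarith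
  have h3 : -(1 - 2 * c * c + c ^ 2 * 1) = c ^ 2 - 1 := by ring
  rw [h3, Real.mul_self_sqrt hp.le]
  congr 1
  field_simp
  ring

theorem exp_edgeLength (e : Fin 6) (he : e ≠ 0) :
    Real.exp (T.edgeLength (fstV e) (sndV e)) = -mink (T.v (fstV e)) (T.v (sndV e)) +
      Real.sqrt (mink (T.v (fstV e)) (T.v (sndV e)) ^ 2 - sgn (fstV e) * sgn (sndV e)) := by
  have mixed (i j : Fin 4) (hi : i < 2) (hj : 2 ≤ j) : Real.exp (T.edgeLength i j) =
      -mink (T.v i) (T.v j) + Real.sqrt (mink (T.v i) (T.v j) ^ 2 - -1) := by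
    have h := T.kept i j hi hj
    have h1 : 1 ≤ Real.sqrt (mink (T.v i) (T.v j) ^ 2 + 1) :=
      Real.one_le_sqrt.2 (by nlinarith)
    rw [T.edgeLength_mixed i j hi hj, Real.exp_arcosh h1, Real.sq_sqrt (by positivity),
      add_sub_cancel_right, Real.sqrt_sq_eq_abs, abs_of_neg h, sub_neg_eq_add, add_comm]
  fin_cases e
  · exact absurd rfl he
  · simpa [fstV, sndV, sgn] using mixed 0 2 (by decide) (by decide)
  · simpa [fstV, sndV, sgn] using mixed 0 3 (by decide) (by decide)
  · simpa [fstV, sndV, sgn] using mixed 1 2 (by decide) (by decide)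
  · simpa [fstV, sndV, sgn] using mixed 1 3 (by decide) (by decide)
  · have h := T.mink_two_three
    have h2 := Real.exp_arcosh (x := -mink (T.v 2) (T.v 3)) (by linarith)
    rw [← T.edgeLength_proper] at h2
    simpa [fstV, sndV, sgn] using h2

theorem lengthFun_angles {z : ℂ} (hz : Complex.cos z = -(T.gramN 2 3 : ℂ)) {w : ℂ}
    (hw : lengthFun epsDT (T.angles z) 0 = w) :
    lengthFun epsDT (T.angles z) = T.lengths w := by
  funext e
  by_cases he : e = 0
  · subst he; exact hw
  · rw [T.lengths_apply w e he, lengthFun,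
      expLength_angles hz e _ (T.angles_apply z e he) (sin_dihedral_nonneg _ _),
      ← T.exp_edgeLength e he, ← Complex.ofReal_log (Real.exp_pos _).le, Real.log_exp]

theorem cos_dihedral_of_mild (h : T.IsMild) :
    Complex.cos (T.dihedral 2 3) = -(T.gramN 2 3 : ℂ) := by
  have hc : mink (T.v 0) (T.v 1) < -1 := h
  have h1 : T.gramN 2 3 ^ 2 < 1 := T.gramN_edge_sq_lt 0 (by
    change 0 < mink (T.v 0) (T.v 1) ^ 2 - -1 * -1
    nlinarith)
  rw [← Complex.ofReal_cos, T.cos_dihedral h1.le, Complex.ofReal_neg]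

theorem expLength_of_mild (h : T.IsMild) :
    expLength epsDT (T.angles (T.dihedral 2 3)) 0 = (Real.exp (T.edgeLength 0 1) : ℝ) := by
  have hc : mink (T.v 0) (T.v 1) < -1 := h
  rw [expLength_angles (T.cos_dihedral_of_mild h) 0 (T.dihedral 2 3) rfl (sin_dihedral_nonneg _ _),
    T.edgeLength_ultra h, Real.exp_arcosh (by linarith)]
  simp [fstV, sndV, sgn]

theorem cos_zero_of_tangent (h : T.IsTangent) : Complex.cos 0 = -(T.gramN 2 3 : ℂ) := by
  rw [T.gramN_two_three_eq h]; simp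

theorem expLength_of_tangent (h : T.IsTangent) : expLength epsDT (T.angles 0) 0 = 1 := by
  have hc : mink (T.v 0) (T.v 1) = -1 := h
  rw [expLength_angles (T.cos_zero_of_tangent h) 0 0 (by simp [angles]) (by simp)]
  simp [fstV, sndV, sgn, hc]

theorem cos_ridgeLength (h : T.IsPrism) :
    Complex.cos (Complex.I * T.ridgeLength) = -(T.gramN 2 3 : ℂ) := by
  have h1 := T.gramN_two_three_lt h
  rw [mul_comm, Complex.cos_mul_I, ← Complex.ofReal_cosh, T.ridgeLength_eq h,
    Real.cosh_arcosh (by linarith), Complex.ofReal_neg]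

theorem ridgeLength_pos (h : T.IsPrism) : 0 < T.ridgeLength := by
  have h1 := T.gramN_two_three_lt h
  rw [T.ridgeLength_eq h]
  exact Real.arcosh_pos (by linarith)

theorem expLength_of_prism (h : T.IsPrism) : expLength epsDT
    (T.angles (Complex.I * T.ridgeLength)) 0 = Complex.exp (Complex.I * T.ridgeAngle) := by
  have hz := T.cos_ridgeLength h
  have h1 := abs_lt.1 (show |mink (T.v 0) (T.v 1)| < 1 from h)
  have hs := sigFun_angles_sq hz 0
  have e0 : T.angles (Complex.I * T.ridgeLength) 0 = Complex.I * T.ridgeLength := rfl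
  rw [expLength, normCof_angles hz]
  rw [sigFun_angles hz, e0, mul_comm Complex.I, Complex.sin_mul_I, ← Complex.ofReal_sinh] at hs ⊢
  set A := Real.sinh T.ridgeLength
  set B := T.ht (fstV 0) * T.ht (sndV 0) / Real.sqrt (-T.gramN.det)
  have hA : 0 ≤ A := Real.sinh_nonneg_iff.2 (T.ridgeLength_pos h).le
  have hB : 0 ≤ B := div_nonneg (mul_pos_of_neg_of_neg (T.ht_neg _) (T.ht_neg _)).le
    (Real.sqrt_nonneg _)
  have hAB : (A * B) ^ 2 = 1 - mink (T.v 0) (T.v 1) ^ 2 := by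
    have h2 : ((-((A * B) ^ 2) : ℝ) : ℂ) =
        (mink (T.v 0) (T.v 1) ^ 2 - sgn (fstV 0) * sgn (sndV 0) : ℝ) := by
      rw [← show fstV 0 = 0 from rfl, ← show sndV 0 = 1 from rfl, ← hs]
      push_cast
      linear_combination (-(A : ℂ) ^ 2 * B ^ 2) * Complex.I_sq
    have h3 := Complex.ofReal_inj.1 h2
    have h4 : sgn (fstV 0) * sgn (sndV 0) = 1 := by simp [fstV, sndV, sgn]
    linarith
  -- Both factors are nonnegative, which selects `e^(iμ)` and not `e^(-iμ)`.
  have hsin : A * B = Real.sin T.ridgeAngle := by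
    rw [ridgeAngle, Real.sin_arccos, neg_sq, ← hAB, Real.sqrt_sq (mul_nonneg hA hB)]
  have hcos : -mink (T.v 0) (T.v 1) = Real.cos T.ridgeAngle :=
    (Real.cos_arccos (by linarith) (by linarith)).symm
  rw [mul_comm Complex.I, Complex.exp_mul_I, ← Complex.ofReal_cos, ← Complex.ofReal_sin, ← hsin,
    ← hcos]
  change ((-mink (T.v 0) (T.v 1) : ℝ) : ℂ) + _ = _
  push_cast
  ring

theorem ridgeAngle_mem (h : T.IsPrism) : T.ridgeAngle ∈ Set.Ioo 0 Real.pi := by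
  have h1 := abs_lt.1 (show |mink (T.v 0) (T.v 1)| < 1 from h)
  refine ⟨Real.arccos_pos.2 (by linarith), lt_of_le_of_ne (Real.arccos_le_pi _) fun h2 => ?_⟩
  have := Real.arccos_eq_pi.1 h2
  linarith

theorem lengthFun_of_mild (h : T.IsMild) : Regular epsDT (T.angles (T.dihedral 2 3)) ∧
    lengthFun epsDT (T.angles (T.dihedral 2 3)) = T.lengths (T.edgeLength 0 1) := by
  have hz := T.cos_dihedral_of_mild h
  have he := T.expLength_of_mild h
  refine ⟨regular_angles hz ?_, T.lengthFun_angles hz ?_⟩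
  · rw [he]; exact Complex.ofReal_mem_slitPlane.2 (Real.exp_pos _)
  · rw [lengthFun, he, ← Complex.ofReal_log (Real.exp_pos _).le, Real.log_exp]

theorem lengthFun_of_tangent (h : T.IsTangent) : Regular epsDT (T.angles 0) ∧
    lengthFun epsDT (T.angles 0) = T.lengths 0 := by
  have hz := T.cos_zero_of_tangent h
  have he := T.expLength_of_tangent h
  refine ⟨regular_angles hz ?_, T.lengthFun_angles hz ?_⟩
  · rw [he]; exact Complex.one_mem_slitPlane
  · rw [lengthFun, he, Complex.log_one]

theorem lengthFun_of_prism (h : T.IsPrism) :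
    Regular epsDT (T.angles (Complex.I * T.ridgeLength)) ∧
    lengthFun epsDT (T.angles (Complex.I * T.ridgeLength)) =
      T.lengths (Complex.I * T.ridgeAngle) := by
  have hz := T.cos_ridgeLength h
  have he := T.expLength_of_prism h
  obtain ⟨h1, h2⟩ := T.ridgeAngle_mem h
  refine ⟨regular_angles hz ?_, T.lengthFun_angles hz ?_⟩
  · rw [he, Complex.mem_slitPlane_iff]
    right
    rw [mul_comm, Complex.exp_ofReal_mul_I_im]
    exact (Real.sin_pos_of_pos_of_lt_pi h1 h2).ne'
  -- The principal logarithm returns `iμ` because `μ` lies in `(-π, π]`.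
  · rw [lengthFun, he, Complex.log_exp]
    · simpa using (neg_neg_of_pos Real.pi_pos).trans h1
    · simpa using h2.le

/-- The dual Jacobian formula at the dihedral angles of a doubly truncated tetrahedron. -/
theorem lengthFun_hasFDerivAt {z : ℂ} (hz : Complex.cos z = -(T.gramN 2 3 : ℂ))
    (hr : Regular epsDT (T.angles z)) (hc : mink (T.v 0) (T.v 1) ^ 2 ≠ 1) :
    HasFDerivAt (lengthFun epsDT)
      (matCLM (jacFormula epsDT (T.angles z) (lengthFun epsDT (T.angles z)))) (T.angles z) :=
  hr.lengthFun_hasFDerivAt epsDT_sq (eta_angles hz) (sigFun_angles_ne_zero hz hc)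

end DoublyTruncated

end DualJacobian
end

/-! ### Openness of the parameter set: tetrahedra from Gram matrices. -/

noncomputable section

namespace DualJacobian

open Matrix

/-- The basis dual to four normals with respect to the Lorentzian inner product. -/
def dualBasis (N : Fin 4 → Fin 4 → ℝ) (j : Fin 4) : Fin 4 → ℝ :=
  fun k => (of N).det⁻¹ * (minkMat * (of N).adjugate) k j

/-- The vertices determined by four normals. -/
def vertexOf (N : Fin 4 → Fin 4 → ℝ) (j : Fin 4) : Fin 4 → ℝ :=
  (-(Real.sqrt (-(DoublyTruncated.sgn j * mink (dualBasis N j) (dualBasis N j))))⁻¹) •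
    dualBasis N j

theorem mink_smul_right (t : ℝ) (x y : Fin 4 → ℝ) : mink x (t • y) = t * mink x y := by
  simp only [mink, Pi.smul_apply, smul_eq_mul]; ring

theorem mink_dualBasis {N : Fin 4 → Fin 4 → ℝ} (h : (of N).det ≠ 0) (i j : Fin 4) :
    mink (N i) (dualBasis N j) = if i = j then 1 else 0 := by
  have h1 : mink (N i) (dualBasis N j) =
      (of N).det⁻¹ * (of N * (minkMat * (minkMat * (of N).adjugate))) i j := by
    simp only [dualBasis, mink, minkMat, mul_apply, Fin.sum_univ_four, of_apply]
    simp
    ring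
  rw [h1, ← Matrix.mul_assoc minkMat, minkMat_mul_self, Matrix.one_mul, mul_adjugate]
  simp [one_apply, h]

theorem eq_of_mink_eq {N : Fin 4 → Fin 4 → ℝ} (h : (of N).det ≠ 0) {x y : Fin 4 → ℝ}
    (hxy : ∀ i, mink (N i) x = mink (N i) y) : x = y := by
  have h1 : (of N) *ᵥ (minkMat *ᵥ x) = (of N) *ᵥ (minkMat *ᵥ y) := by
    ext i
    have := hxy i
    simp only [mink] at this
    simp [mulVec, dotProduct, Fin.sum_univ_four, minkMat, diagonal_apply]
    linarith
  have h2 := mulVec_injective_iff_isUnit.2 ((isUnit_iff_isUnit_det _).2 h.isUnit) h1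
  have h3 := congrArg (minkMat *ᵥ ·) h2
  simpa [mulVec_mulVec, minkMat_mul_self] using h3

theorem continuousAt_mink {X : Type*} [TopologicalSpace X] {f g : X → Fin 4 → ℝ} {x : X}
    (hf : ContinuousAt f x) (hg : ContinuousAt g x) :
    ContinuousAt (fun t => mink (f t) (g t)) x := by
  have hf' := fun i => (continuousAt_pi.1 hf) i
  have hg' := fun i => (continuousAt_pi.1 hg) i
  exact (((((hf' 0).mul (hg' 0)).neg.add ((hf' 1).mul (hg' 1))).add ((hf' 2).mul (hg' 2))).add
    ((hf' 3).mul (hg' 3)))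

theorem continuousAt_dualBasis {N : Fin 4 → Fin 4 → ℝ} (h : (of N).det ≠ 0) (j : Fin 4) :
    ContinuousAt (fun M => dualBasis M j) N := by
  have hc : Continuous fun M : Fin 4 → Fin 4 → ℝ => (of M : Matrix (Fin 4) (Fin 4) ℝ) :=
    continuous_id
  refine continuousAt_pi.2 fun k => ?_
  exact (hc.matrix_det.continuousAt.inv₀ h).mul
    ((continuous_const.matrix_mul hc.matrix_adjugate).matrix_elem k j).continuousAt

/-- The Gram matrix entries on and above the diagonal. -/
def gramMap (N : Fin 4 → Fin 4 → ℝ) : {q : Fin 4 × Fin 4 // q.1 ≤ q.2} → ℝ :=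
  fun q => mink (N q.1.1) (N q.1.2)

theorem contDiff_gramMap : ContDiff ℝ 1 gramMap := by
  unfold gramMap mink
  fun_prop

theorem fderiv_gramMap (N M : Fin 4 → Fin 4 → ℝ) (q : {q : Fin 4 × Fin 4 // q.1 ≤ q.2}) :
    fderiv ℝ gramMap N M q = mink (M q.1.1) (N q.1.2) + mink (N q.1.1) (M q.1.2) := by
  have h1 := hasDerivAt_pi.1
    ((contDiff_gramMap.differentiable one_ne_zero N).hasFDerivAt.hasLineDerivAt M) q
  have hl (i k : Fin 4) : HasDerivAt (fun t : ℝ => (N + t • M) i k) (M i k) 0 := by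
    simpa using ((hasDerivAt_id (0 : ℝ)).mul_const (M i k)).const_add (N i k)
  have hm (k : Fin 4) := (hl q.1.1 k).fun_mul (hl q.1.2 k)
  have h2 := ((((hm 0).fun_neg.fun_add (hm 1)).fun_add (hm 2)).fun_add (hm 3))
  rw [h1.unique h2]
  simp [mink]
  ring

/-- The Gram map is a submersion at a basis. Its target consists of the entries with `i ≤ j`, since
onto all matrices it could not be open. -/
theorem map_nhds_gramMap {N : Fin 4 → Fin 4 → ℝ} (h : (of N).det ≠ 0) :
    Filter.map gramMap (nhds N) = nhds (gramMap N) := by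
  refine (contDiff_gramMap.contDiffAt.hasStrictFDerivAt one_ne_zero).map_nhds_eq_of_surj ?_
  refine LinearMap.range_eq_top.2 fun S => ?_
  set S' : Fin 4 → Fin 4 → ℝ := fun i j =>
    if hij : i ≤ j then S ⟨(i, j), hij⟩ else S ⟨(j, i), (not_le.1 hij).le⟩ with hS'
  have hsym (i j : Fin 4) : S' i j = S' j i := by
    rcases lt_trichotomy i j with hij | hij | hij
    · simp [hS', hij.le, not_le.2 hij]
    · rw [hij]
    · simp [hS', hij.le, not_le.2 hij]
  have hm (i k : Fin 4) :
      mink (N k) (∑ j, (S' i j / 2) • dualBasis N j) = S' i k / 2 := by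
    have hlin : mink (N k) (∑ j, (S' i j / 2) • dualBasis N j) =
        ∑ j, S' i j / 2 * mink (N k) (dualBasis N j) := by
      simp only [Fin.sum_univ_four, mink, Pi.add_apply, Pi.smul_apply, smul_eq_mul]; ring
    rw [hlin]
    simp [mink_dualBasis h]
  -- Moving `N i` by half the `i`-th row of the symmetric matrix, in dual coordinates, contributes
  -- half of `S` from each argument of `mink`.
  refine ⟨fun i => ∑ j, (S' i j / 2) • dualBasis N j, funext fun q => ?_⟩
  refine (fderiv_gramMap N _ q).trans ?_
  rw [mink_comm, hm, hm, hsym q.1.2, add_halves]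
  simp only [hS', dif_pos q.2]

/-- The Gram matrix of a prism truncated tetrahedron in terms of its parameters. -/
def prismGram (p : Fin 6 → ℝ) : Matrix (Fin 4) (Fin 4) ℝ :=
  !![1, -Real.cos (p 1), -Real.cos (p 4), -Real.cos (p 3);
     -Real.cos (p 1), 1, -Real.cos (p 5), -Real.cos (p 2);
     -Real.cos (p 4), -Real.cos (p 5), 1, -Real.cosh (p 0);
     -Real.cos (p 3), -Real.cos (p 2), -Real.cosh (p 0), 1]

theorem continuous_prismGram (i j : Fin 4) : Continuous fun p => prismGram p i j := by
  fin_cases i <;> fin_cases j <;> simp [prismGram] <;> fun_prop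

namespace DoublyTruncated

variable (T : DoublyTruncated)

theorem dualBasis_normals (j : Fin 4) : dualBasis T.n j = (T.ht j)⁻¹ • T.v j := by
  refine eq_of_mink_eq T.normals_det_ne_zero fun i => ?_
  rw [mink_dualBasis T.normals_det_ne_zero, mink_smul_right]
  split_ifs with h
  · rw [h]; exact (inv_mul_cancel₀ (T.ht_ne_zero j)).symm
  · rw [T.normal_orth i j h, mul_zero]

theorem sgn_mul_dualBasis (j : Fin 4) :
    -(sgn j * mink (dualBasis T.n j) (dualBasis T.n j)) = ((-T.ht j)⁻¹) ^ 2 := by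
  rw [dualBasis_normals, mink_smul_smul, T.mink_self]
  have := T.ht_ne_zero j
  field_simp
  linear_combination sgn_sq j

/-- The norm of `v j` fixes it up to sign on the line of the dual vector; the minus sign in
`vertexOf` reflects that the normals are outer. -/
theorem vertexOf_normals (j : Fin 4) : vertexOf T.n j = T.v j := by
  have h := T.ht_neg j
  rw [vertexOf, sgn_mul_dualBasis, Real.sqrt_sq (inv_nonneg.2 (by linarith)), dualBasis_normals,
    inv_inv, neg_neg, smul_smul, mul_inv_cancel₀ h.ne, one_smul]

theorem sgn_mul_dualBasis_pos (j : Fin 4) :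
    0 < -(sgn j * mink (dualBasis T.n j) (dualBasis T.n j)) := by
  rw [sgn_mul_dualBasis]
  have := T.ht_neg j
  have : 0 < (-T.ht j)⁻¹ := inv_pos.2 (by linarith)
  positivity

theorem continuousAt_vertexOf (j : Fin 4) : ContinuousAt (fun N => vertexOf N j) T.n := by
  have h := continuousAt_dualBasis T.normals_det_ne_zero j
  have h1 : ContinuousAt (fun N => Real.sqrt (-(sgn j * mink (dualBasis N j) (dualBasis N j))))
      T.n := ((continuousAt_mink h h).const_mul (sgn j)).neg.sqrt
  exact (h1.inv₀ (Real.sqrt_pos.2 (T.sgn_mul_dualBasis_pos j)).ne').neg.smul h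

/-- Unit normals close to those of a prism truncated tetrahedron are the normals of a prism
truncated tetrahedron. -/
theorem eventually_exists_isPrism (h : T.IsPrism) : ∀ᶠ N in nhds T.n,
    (∀ i, mink (N i) (N i) = 1) → ∃ T' : DoublyTruncated, T'.IsPrism ∧ T'.n = N := by
  -- The inequalities defining a prism truncated tetrahedron are strict and the vertices depend
  -- continuously on the normals. The equations hold by construction, except that the normals are
  -- units.
  have hv := T.continuousAt_vertexOf
  have hW (i j : Fin 4) := continuousAt_mink (hv i) (hv j)
  have c1 : ∀ᶠ N : Fin 4 → Fin 4 → ℝ in nhds T.n, (of N).det ≠ 0 := by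
    have hc : Continuous fun M : Fin 4 → Fin 4 → ℝ => (of M : Matrix (Fin 4) (Fin 4) ℝ) :=
      continuous_id
    exact hc.matrix_det.continuousAt.eventually_ne T.normals_det_ne_zero
  have c2 : ∀ᶠ N in nhds T.n, ∀ j, 0 < -(sgn j * mink (dualBasis N j) (dualBasis N j)) := by
    refine Filter.eventually_all.2 fun j => ?_
    have hd := continuousAt_dualBasis T.normals_det_ne_zero j
    exact ((continuousAt_mink hd hd).const_mul (sgn j)).neg.eventually_const_lt
      (T.sgn_mul_dualBasis_pos j)
  have c3 : ∀ᶠ N in nhds T.n, ∀ j, 2 ≤ j → 0 < vertexOf N j 0 := by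
    refine Filter.eventually_all.2 fun j => ?_
    by_cases hj : 2 ≤ j
    · have h0 : 0 < vertexOf T.n j 0 := by rw [vertexOf_normals]; exact (T.proper j hj).2
      filter_upwards [(continuousAt_pi.1 (hv j) 0).eventually_const_lt h0] with N hN _ using hN
    · exact Filter.Eventually.of_forall fun N h => absurd h hj
  have c4 : ∀ᶠ N in nhds T.n, ∀ i j, i < 2 → 2 ≤ j → mink (vertexOf N i) (vertexOf N j) < 0 := by
    refine Filter.eventually_all.2 fun i => Filter.eventually_all.2 fun j => ?_
    by_cases hi : i < 2
    · by_cases hj : 2 ≤ j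
      · have h0 : mink (vertexOf T.n i) (vertexOf T.n j) < 0 := by
          rw [vertexOf_normals, vertexOf_normals]; exact T.kept i j hi hj
        filter_upwards [(hW i j).eventually_lt_const h0] with N hN _ _ using hN
      · exact Filter.Eventually.of_forall fun N _ h => absurd h hj
    · exact Filter.Eventually.of_forall fun N h => absurd h hi
  have c5 : ∀ᶠ N in nhds T.n, ∀ i k j, i < 2 → k < 2 → i ≠ k → 2 ≤ j →
      mink (vertexOf N j - mink (vertexOf N i) (vertexOf N j) • vertexOf N i) (vertexOf N k)
        < 0 := by
    refine Filter.eventually_all.2 fun i => Filter.eventually_all.2 fun k =>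
      Filter.eventually_all.2 fun j => ?_
    by_cases hh : i < 2 ∧ k < 2 ∧ i ≠ k ∧ 2 ≤ j
    · obtain ⟨h1, h2, h3, h4⟩ := hh
      have h0 : mink (vertexOf T.n j - mink (vertexOf T.n i) (vertexOf T.n j) • vertexOf T.n i)
          (vertexOf T.n k) < 0 := by
        simp only [vertexOf_normals]; exact T.cut i k j h1 h2 h3 h4
      filter_upwards [(continuousAt_mink ((hv j).sub ((hW i j).smul (hv i)))
        (hv k)).eventually_lt_const h0] with N hN _ _ _ _ using hN
    · exact Filter.Eventually.of_forall fun N h1 h2 h3 h4 => absurd ⟨h1, h2, h3, h4⟩ hh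
  have h01 : |mink (vertexOf T.n 0) (vertexOf T.n 1)| < 1 := by
    rw [vertexOf_normals, vertexOf_normals]; exact h
  have c6 : ∀ᶠ N in nhds T.n, |mink (vertexOf N 0) (vertexOf N 1)| < 1 :=
    (hW 0 1).abs.eventually_lt_const h01
  filter_upwards [c1, c2, c3, c4, c5, c6] with N k1 k2 k3 k4 k5 k6 hunit
  have hself (j : Fin 4) : mink (vertexOf N j) (vertexOf N j) = -sgn j := by
    have h1 := Real.sq_sqrt (k2 j).le
    have h2 := (Real.sqrt_pos.2 (k2 j)).ne'
    rw [vertexOf, mink_smul_smul]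
    field_simp
    rw [h1]
    linear_combination (-mink (dualBasis N j) (dualBasis N j)) * sgn_sq j
  have hnv (i j : Fin 4) : mink (N i) (vertexOf N j) =
      -(Real.sqrt (-(sgn j * mink (dualBasis N j) (dualBasis N j))))⁻¹ *
        if i = j then 1 else 0 := by
    rw [vertexOf, mink_smul_right, mink_dualBasis k1]
  refine ⟨{ v := vertexOf N, n := N, ultra := fun i hi => ?_, proper := fun j hj => ⟨?_, k3 j hj⟩,
            normal_unit := hunit, normal_orth := fun i j hij => ?_, normal_outer := fun i => ?_,
            kept := k4, cut := k5 }, k6, rfl⟩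
  · rw [hself]
    fin_cases i
    · simp [sgn]
    · simp [sgn]
    · exact absurd hi (by decide)
    · exact absurd hi (by decide)
  · rw [hself]
    fin_cases j
    · exact absurd hj (by decide)
    · exact absurd hj (by decide)
    · simp [sgn]
    · simp [sgn]
  · rw [hnv, if_neg hij, mul_zero]
  · rw [hnv, if_pos rfl, mul_one]
    exact neg_neg_of_pos (inv_pos.2 (Real.sqrt_pos.2 (k2 i)))

theorem prismGram_prismParams (h : T.IsPrism) : prismGram T.prismParams = T.gramN := by
  have h1 := T.gramN_two_three_lt h
  have hc : Real.cosh T.ridgeLength = -T.gramN 2 3 := by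
    rw [T.ridgeLength_eq h, Real.cosh_arcosh (by linarith)]
  have hd (e : Fin 6) (he : e ≠ 0) := T.cos_dihedral (T.gramN_edge_sq e he).le
  have d1 := hd 1 (by decide)
  have d2 := hd 2 (by decide)
  have d3 := hd 3 (by decide)
  have d4 := hd 4 (by decide)
  have d5 := hd 5 (by decide)
  simp [fstO, sndO] at d1 d2 d3 d4 d5
  have hs := T.gramN_comm
  ext i j
  fin_cases i <;> fin_cases j <;>
    simp [prismGram, prismParams, hc, d1, d2, d3, d4, d5, T.gramN_self, hs 1 0, hs 2 0, hs 3 0,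
      hs 2 1, hs 3 1, hs 3 2]

theorem prismParams_eq (h : T.IsPrism) {p : Fin 6 → ℝ} (h0 : 0 ≤ p 0)
    (hp : ∀ i, i ≠ 0 → p i ∈ Set.Ioo 0 Real.pi) (hg : T.gramN = prismGram p) :
    T.prismParams = p := by
  have hd (i j : Fin 4) (k : Fin 6) (hk : k ≠ 0) (hij : T.gramN i j = -Real.cos (p k)) :
      T.dihedral i j = p k := by
    change Real.arccos (-T.gramN i j) = _
    rw [hij, neg_neg, Real.arccos_cos (hp k hk).1.le (hp k hk).2.le]
  funext k
  fin_cases k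
  · change T.ridgeLength = p 0
    rw [T.ridgeLength_eq h, hg]
    simp [prismGram, Real.arcosh_cosh h0]
  · exact hd 0 1 1 (by decide) (by rw [hg]; rfl)
  · exact hd 1 3 2 (by decide) (by rw [hg]; rfl)
  · exact hd 0 3 3 (by decide) (by rw [hg]; rfl)
  · exact hd 0 2 4 (by decide) (by rw [hg]; rfl)
  · exact hd 1 2 5 (by decide) (by rw [hg]; rfl)

theorem eventually_prismParams (h : T.IsPrism) : ∀ᶠ p in nhds T.prismParams,
    ∃ T' : DoublyTruncated, T'.IsPrism ∧ T'.prismParams = p := by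
  have hm (e : Fin 6) (he : e ≠ 0) := T.dihedral_mem (T.gramN_edge_sq e he)
  have hpos : ∀ᶠ p in nhds T.prismParams, 0 < p 0 :=
    (continuous_apply 0).continuousAt.eventually_const_lt (T.ridgeLength_pos h)
  have hIoo : ∀ᶠ p in nhds T.prismParams, ∀ i, i ≠ 0 → p i ∈ Set.Ioo 0 Real.pi := by
    refine Filter.eventually_all.2 fun i => ?_
    by_cases hi : i = 0
    · exact Filter.Eventually.of_forall fun p hp => absurd hi hp
    · have hmem : T.prismParams i ∈ Set.Ioo 0 Real.pi := by
        fin_cases i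
        · exact absurd rfl hi
        · exact hm 5 (by decide)
        · exact hm 1 (by decide)
        · exact hm 3 (by decide)
        · exact hm 4 (by decide)
        · exact hm 2 (by decide)
      filter_upwards [(continuous_apply i).continuousAt.eventually_mem
        (isOpen_Ioo.mem_nhds hmem)] with p hp _ using hp
  set Γ : (Fin 6 → ℝ) → ({q : Fin 4 × Fin 4 // q.1 ≤ q.2} → ℝ) :=
    fun p q => prismGram p q.1.1 q.1.2 with hΓ
  have hΓc : Continuous Γ := continuous_pi fun q => continuous_prismGram _ _
  have hΓ0 : Γ T.prismParams = gramMap T.n := by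
    funext q
    rw [hΓ]
    simp only [T.prismGram_prismParams h]
    rfl
  -- Normals need not be chosen continuously in `p`: the image of a neighbourhood of `T.n` is a
  -- neighbourhood of its Gram data.
  have himg : gramMap '' {N | (∀ i, mink (N i) (N i) = 1) →
      ∃ T' : DoublyTruncated, T'.IsPrism ∧ T'.n = N} ∈ nhds (Γ T.prismParams) := by
    rw [hΓ0, ← map_nhds_gramMap T.normals_det_ne_zero]
    exact Filter.image_mem_map (T.eventually_exists_isPrism h)
  filter_upwards [hpos, hIoo, hΓc.continuousAt.eventually_mem himg] with p h0 hp hN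
  obtain ⟨N, hN, hNp⟩ := hN
  have hle (i j : Fin 4) (hij : i ≤ j) : mink (N i) (N j) = prismGram p i j :=
    congrFun hNp ⟨(i, j), hij⟩
  have hsym (i j : Fin 4) : prismGram p i j = prismGram p j i := by
    fin_cases i <;> fin_cases j <;> rfl
  have hall (i j : Fin 4) : mink (N i) (N j) = prismGram p i j := by
    rcases le_total i j with hij | hij
    · exact hle i j hij
    · rw [mink_comm, hsym]; exact hle j i hij
  -- The unit condition is the diagonal of `prismGram p`.
  obtain ⟨T', hT', rfl⟩ := hN fun i => by
    rw [hall]; fin_cases i <;> rfl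
  exact ⟨T', hT', T'.prismParams_eq hT' h0.le hp (by ext i j; exact hall i j)⟩

end DoublyTruncated

theorem isOpen_prismParams :
    IsOpen {p : Fin 6 → ℝ | ∃ T : DoublyTruncated, T.IsPrism ∧ T.prismParams = p} := by
  rw [isOpen_iff_mem_nhds]
  rintro _ ⟨T, hT, rfl⟩
  exact T.eventually_prismParams hT

/-! ### The real dual Jacobian by restriction to the prism parameters. -/

/-- The position of each edge of the list `12, 13, 14, 23, 24, 34` in the list
`12, 34, 13, 23, 24, 14`. -/
def reorderInv : Fin 6 → Fin 6 := ![0, 2, 5, 3, 4, 1]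

/-- The complex angles belonging to the parameters of a prism truncated tetrahedron. -/
def prismAngles : (Fin 6 → ℝ) →L[ℝ] (Fin 6 → ℂ) :=
  ContinuousLinearMap.pi fun k => rot (reorderInv k) •
    (Complex.ofRealCLM.comp (ContinuousLinearMap.proj (R := ℝ) (φ := fun _ : Fin 6 => ℝ)
      (reorderInv k)))

theorem prismAngles_apply (p : Fin 6 → ℝ) (k : Fin 6) :
    prismAngles p k = rot (reorderInv k) * (p (reorderInv k) : ℂ) := rfl

theorem prismAngles_single (f : Fin 6) :
    prismAngles (Pi.single f 1) = rot f • Pi.single (reorder f) (1 : ℂ) := by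
  funext k
  rw [prismAngles_apply]
  fin_cases f <;> fin_cases k <;> simp [rot, reorderInv, reorder]

theorem rot_ne_zero (e : Fin 6) : rot e ≠ 0 := by fin_cases e <;> simp [rot]

/-- The complex duals as a function of the parameters of a prism truncated tetrahedron. -/
def prismLengths (p : Fin 6 → ℝ) (e : Fin 6) : ℂ :=
  (rot e)⁻¹ * lengthFun epsDT (prismAngles p) (reorder e)

/-- `(μ, ℓ₁, ℓ₂, ℓ₃, ℓ₅, ℓ₆)` as a function of `(ℓ, θ₁, θ₂, θ₃, θ₅, θ₆)`. -/
def prismDualFun (p : Fin 6 → ℝ) (e : Fin 6) : ℝ := (prismLengths p e).re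

namespace DoublyTruncated

variable (T : DoublyTruncated)

theorem prismAngles_prismParams :
    prismAngles T.prismParams = T.angles (Complex.I * T.ridgeLength) := by
  funext k
  rw [prismAngles_apply]
  fin_cases k <;> simp [rot, reorderInv, prismParams, angles]

theorem prismLengths_prismParams (h : T.IsPrism) (e : Fin 6) :
    prismLengths T.prismParams e = (T.prismDuals e : ℂ) := by
  rw [prismLengths, prismAngles_prismParams, (T.lengthFun_of_prism h).2,
    inv_mul_eq_iff_eq_mul₀ (rot_ne_zero e)]
  fin_cases e <;> simp [rot, reorder, prismDuals, lengths]

theorem prismDualFun_prismParams (h : T.IsPrism) : prismDualFun T.prismParams = T.prismDuals := by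
  funext e
  rw [prismDualFun, T.prismLengths_prismParams h, Complex.ofReal_re]

theorem hasFDerivAt_lengthFun_of_prism (h : T.IsPrism) :
    HasFDerivAt (lengthFun epsDT) (matCLM (jacFormula epsDT
      (T.angles (Complex.I * T.ridgeLength)) (T.lengths (Complex.I * T.ridgeAngle))))
      (T.angles (Complex.I * T.ridgeLength)) := by
  obtain ⟨hr, hl⟩ := T.lengthFun_of_prism h
  have hc : mink (T.v 0) (T.v 1) ^ 2 < 1 := (sq_lt_one_iff_abs_lt_one _).2 h
  have := T.lengthFun_hasFDerivAt (T.cos_ridgeLength h) hr hc.ne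
  rwa [hl] at this

/-- The dual Jacobian of a prism truncated tetrahedron. -/
theorem exists_hasFDerivAt_prismDualFun (h : T.IsPrism) : ∃ J : Matrix (Fin 6) (Fin 6) ℝ,
    HasFDerivAt prismDualFun (matCLM J) T.prismParams ∧
    ∀ e f : Fin 6, rot e * (J e f : ℂ) = jacFormula epsDT (T.angles (Complex.I * T.ridgeLength))
      (T.lengths (Complex.I * T.ridgeAngle)) (reorder e) (reorder f) * rot f := by
  have hΛ := T.hasFDerivAt_lengthFun_of_prism h
  set M := jacFormula epsDT (T.angles (Complex.I * T.ridgeLength))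
    (T.lengths (Complex.I * T.ridgeAngle))
  rw [← T.prismAngles_prismParams] at hΛ
  have h1 : HasFDerivAt (fun p => lengthFun epsDT (prismAngles p))
      (((matCLM M).restrictScalars ℝ).comp prismAngles) T.prismParams :=
    (hΛ.restrictScalars ℝ).comp _ prismAngles.hasFDerivAt
  have h2 (e : Fin 6) := (hasFDerivAt_pi'.1 h1 (reorder e)).const_mul ((rot e)⁻¹)
  set D : Fin 6 → (Fin 6 → ℝ) →L[ℝ] ℂ := fun e => (rot e)⁻¹ •
    ((ContinuousLinearMap.proj (reorder e)).comp
      (((matCLM M).restrictScalars ℝ).comp prismAngles)) with hD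
  have hDf (e f : Fin 6) : rot e * D e (Pi.single f 1) = M (reorder e) (reorder f) * rot f := by
    have : D e (Pi.single f 1) = (rot e)⁻¹ * (matCLM M (prismAngles (Pi.single f 1))) (reorder e) :=
      rfl
    rw [this, mul_inv_cancel_left₀ (rot_ne_zero e), prismAngles_single, map_smul]
    simp [matCLM, mul_comm]
  have hre (e : Fin 6) : HasFDerivAt (fun p => prismDualFun p e) (Complex.reCLM.comp (D e))
      T.prismParams := Complex.reCLM.hasFDerivAt.comp _ (h2 e)
  have him (e : Fin 6) : HasFDerivAt (fun p => (prismLengths p e).im) (Complex.imCLM.comp (D e))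
      T.prismParams := Complex.imCLM.hasFDerivAt.comp _ (h2 e)
  -- Openness enters here: every nearby parameter belongs to a prism truncated tetrahedron, where
  -- the rotated lengths are real. The imaginary part thus vanishes identically nearby, and so does
  -- its derivative.
  have him0 (e : Fin 6) : Complex.imCLM.comp (D e) = 0 := by
    refine (him e).unique ((hasFDerivAt_const (0 : ℝ) _).congr_of_eventuallyEq ?_)
    filter_upwards [T.eventually_prismParams h] with p hp
    obtain ⟨T', hT', rfl⟩ := hp
    rw [T'.prismLengths_prismParams hT', Complex.ofReal_im]
  have hF : HasFDerivAt prismDualFun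
      (ContinuousLinearMap.pi fun e => Complex.reCLM.comp (D e)) T.prismParams :=
    hasFDerivAt_pi.2 hre
  refine ⟨of fun e f => (D e (Pi.single f 1)).re,
    hasFDerivAt_matCLM hF.differentiableAt fun e f => ?_, fun e f => ?_⟩
  · rw [hF.fderiv]; rfl
  · rw [← hDf]
    congr 1
    have him1 : (D e (Pi.single f 1)).im = 0 := DFunLike.congr_fun (him0 e) (Pi.single f 1)
    exact Complex.ext rfl him1.symm

end DoublyTruncated

end DualJacobian
end

open DualJacobian in
theorem mainTheorem2 :
    -- on prism truncated tetrahedra, `(μ, ℓ₁, ℓ₂, ℓ₃, ℓ₅, ℓ₆)` is a function `F` of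
    -- `(ℓ, θ₁, θ₂, θ₃, θ₅, θ₆)`, and these parameters vary over an open set
    IsOpen {p : Fin 6 → ℝ | ∃ T : DoublyTruncated, T.IsPrism ∧ T.prismParams = p} ∧
    ∃ (F : (Fin 6 → ℝ) → (Fin 6 → ℝ)) (Λ : (Fin 6 → ℂ) → (Fin 6 → ℂ)),
      (∀ T : DoublyTruncated, T.IsPrism → F T.prismParams = T.prismDuals) ∧
      -- `Λ` gives the edge lengths of mildly doubly truncated tetrahedra, with Jacobian matrix
      -- given by the formula
      (∀ T : DoublyTruncated, T.IsMild →
        AnalyticAt ℂ Λ (T.angles (T.dihedral 2 3)) ∧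
        Λ (T.angles (T.dihedral 2 3)) = T.lengths (T.edgeLength 0 1) ∧
        HasFDerivAt Λ (matCLM (jacFormula epsDT (T.angles (T.dihedral 2 3))
          (T.lengths (T.edgeLength 0 1)))) (T.angles (T.dihedral 2 3))) ∧
      -- `Λ` continues analytically through the limiting case of tangent truncating planes
      (∀ T : DoublyTruncated, T.IsTangent →
        AnalyticAt ℂ Λ (T.angles 0) ∧ Λ (T.angles 0) = T.lengths 0) ∧
      -- and to the prism truncated tetrahedra by `a₁₂ = i ℓ`, `ℓ₁₂ = i μ`; the same formula
      -- gives its Jacobian matrix there, and this matrix is the dual Jacobian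
      (∀ T : DoublyTruncated, T.IsPrism →
        AnalyticAt ℂ Λ (T.angles (Complex.I * T.ridgeLength)) ∧
        Λ (T.angles (Complex.I * T.ridgeLength)) = T.lengths (Complex.I * T.ridgeAngle) ∧
        HasFDerivAt Λ (matCLM (jacFormula epsDT (T.angles (Complex.I * T.ridgeLength))
          (T.lengths (Complex.I * T.ridgeAngle)))) (T.angles (Complex.I * T.ridgeLength)) ∧
        ∃ J : Matrix (Fin 6) (Fin 6) ℝ,
          HasFDerivAt F (matCLM J) T.prismParams ∧
          ∀ e f : Fin 6, rot e * (J e f : ℂ) =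
            jacFormula epsDT (T.angles (Complex.I * T.ridgeLength))
              (T.lengths (Complex.I * T.ridgeAngle)) (reorder e) (reorder f) * rot f) := by
  refine ⟨isOpen_prismParams, prismDualFun, lengthFun epsDT,
    fun T h => T.prismDualFun_prismParams h, fun T h => ?_, fun T h => ?_, fun T h => ?_⟩
  · obtain ⟨hr, hl⟩ := T.lengthFun_of_mild h
    have hc : mink (T.v 0) (T.v 1) < -1 := h
    refine ⟨hr.lengthFun_analyticAt, hl, ?_⟩
    have := T.lengthFun_hasFDerivAt (T.cos_dihedral_of_mild h) hr (by nlinarith)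
    rwa [hl] at this
  · obtain ⟨hr, hl⟩ := T.lengthFun_of_tangent h
    exact ⟨hr.lengthFun_analyticAt, hl⟩
  · obtain ⟨hr, hl⟩ := T.lengthFun_of_prism h
    exact ⟨hr.lengthFun_analyticAt, hl, T.hasFDerivAt_lengthFun_of_prism h,
      T.exists_hasFDerivAt_prismDualFun h⟩
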